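/- **Theorem (Mesoscopic dynamics of a single superconductor).** Let $\beta,T_c>0$ and $\epsilon\in\mathbb R$, and suppose the system is in the superconducting phase, i.e. there is $\Delta>0$ with $$\frac{\omega}{T_c}=\tanh(\beta\omega),\qquad \omega=\sqrt{\epsilon^2+4T_c^2\Delta^2}.$$ On $(\mathbb C^2)^{\otimes N}$ let $S^N_i=\frac12\sum_{k=1}^N\sigma_i^{(k)}$ $(i=x,y,z)$, $S^N_\pm=S^N_x\pm iS^N_y$, and $$H^N=-2\epsilon S^N_z-\frac{2T_c}{N}S^N_+S^N_-,\qquad \mathcal H^N=H^N+\mu\sum_{k=1}^N\sigma_z^{(k)}\quad(\mu\in\mathbb R).$$ Let $|s,s_z\rangle_\alpha$ be any orthonormal basis of $(\mathbb C^2)^{\otimes N}$ consisting of joint eigenvectors of $(\vec S^N)^2$ (eigenvalue $s(s+1)$, $s\ge 0$) and $S^N_z$ (eigenvalue $s_z$), let $\eta^N(s,s_z)=-2\epsilon s_z-\frac{2T_c}{N}\bigl(s(s+1)-s_z(s_z-1)\bigr)$ be the corresponding eigenvalues of $H^N$, let $\rho^N_\beta(s,s_z)$ be the Boltzmann weights proportional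 to $e^{-\beta\eta^N(s,s_z)}$, normalised so that their sum over all basis vectors is $1$, and let $$|\Omega^N_\beta\rangle=\sum_{s,s_z,\alpha}\sqrt{\rho^N_\beta(s,s_z)}\;|s,s_z\rangle_\alpha\otimes|s,s_z\rangle_\alpha$$ be the purification (GNS vector) of the Gibbs state $\rho^N_\beta=e^{-\beta H^N}/\mathrm{Tr}\,e^{-\beta H^N}$. Then $$\lim_{N\to\infty}\frac1{N^2}\mathrm{Tr}\bigl[\rho_\beta^N S^N_+S^N_-\bigr]=\mathfrak c^2\quad\text{with }\mathfrak c=\Delta .$$ Put $E^N_\pm=\frac{1}{\mathfrak cN}S^N_\pm\otimes\mathbb I$ and $$\mathcal U^N(t)=e^{-it(\mathcal H^N\otimes\mathbb I-\mathbb I\otimes\mathcal H^N)}.$$ On $L^2$ of the circle $\mathbb R/2\pi\mathbb Z$ let $e^{i\alpha\hat p_\varphi}$ and $e^{in\hat\varphi}$ be the Weyl operators $(e^{i\alpha\hat p_\varphi}\psi)(\varphi)=\psi(\varphi+\alpha)$, $(e^{in\hat\varphi}\psi)(\varphi)=e^{in\varphi}\psi(\varphi)$, and let $|0\rangle$ be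 the normalised constant function. Then for all $\mu,t\in\mathbb R$ the operators $\mathcal U^N(t)$ converge in the mesoscopic limit to $\mathcal U(t)=e^{-it(2\mu\hat p_\varphi)}$, that is, for all $n,n',m,m'\in\mathbb N$, $$\lim_{N\to\infty}\langle\Omega^N_\beta|(E^N_-)^n(E^N_+)^{n'}\,\mathcal U^N(t)\,(E^N_+)^m(E^N_-)^{m'}|\Omega^N_\beta\rangle=\langle 0|e^{-i(n-n')\hat\varphi}\,e^{-it(2\mu\hat p_\varphi)}\,e^{i(m-m')\hat\varphi}|0\rangle .$$ In particular, for all $t\in\mathbb R$ the operators $e^{-it(H^N\otimes\mathbb I-\mathbb I\otimes H^N)}$ converge in the same sense to the identity: the strong-coupling BCS Hamiltonian itself induces no mesoscopic dynamics. -/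

import Mathlib

open Filter Topology MeasureTheory
open scoped Kronecker Matrix

noncomputable section

namespace MesoBCS

/-! ### Collective quasi-spin operators on `(ℂ²)^{⊗N}` -/

/-- Labels of the computational basis of `(ℂ²)^{⊗N}`. -/
abbrev Conf (N : ℕ) : Type := Fin N → Fin 2

/-- Operators on `(ℂ²)^{⊗N}`, as matrices in the computational basis. -/
abbrev Op (N : ℕ) : Type := Matrix (Conf N) (Conf N) ℂ

/-- Operators on the doubled space `(ℂ²)^{⊗N} ⊗ (ℂ²)^{⊗N}`. -/
abbrev Op2 (N : ℕ) : Type := Matrix (Conf N × Conf N) (Conf N × Conf N) ℂ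

def pauliX : Matrix (Fin 2) (Fin 2) ℂ := !![0, 1; 1, 0]

def pauliY : Matrix (Fin 2) (Fin 2) ℂ := !![0, -Complex.I; Complex.I, 0]

def pauliZ : Matrix (Fin 2) (Fin 2) ℂ := !![1, 0; 0, -1]

/-- The one-site operator `A` acting on the `k`-th tensor factor (and as the identity on the
others). -/
def siteOp {N : ℕ} (k : Fin N) (A : Matrix (Fin 2) (Fin 2) ℂ) : Op N :=
  fun x y => if ∀ j, j ≠ k → x j = y j then A (x k) (y k) else 0

/-- `½ ∑ₖ A⁽ᵏ⁾`. -/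
def collective (N : ℕ) (A : Matrix (Fin 2) (Fin 2) ℂ) : Op N :=
  (1 / 2 : ℂ) • ∑ k : Fin N, siteOp k A

def Sx (N : ℕ) : Op N := collective N pauliX

def Sy (N : ℕ) : Op N := collective N pauliY

def Sz (N : ℕ) : Op N := collective N pauliZ

def Sp (N : ℕ) : Op N := Sx N + Complex.I • Sy N

def Sm (N : ℕ) : Op N := Sx N - Complex.I • Sy N

/-- The Casimir operator `S² = Sx² + Sy² + Sz²`. -/
def casimir (N : ℕ) : Op N := Sx N * Sx N + Sy N * Sy N + Sz N * Sz N

/-! ### The strong-coupling BCS Hamiltonian and its Gibbs state -/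

/-- `H^N = -2 ε Sz - (2 Tc / N) S₊ S₋`. -/
def bcsH (ε Tc : ℝ) (N : ℕ) : Op N :=
  -((2 * ε : ℝ) : ℂ) • Sz N - ((2 * Tc / N : ℝ) : ℂ) • (Sp N * Sm N)

/-- The Hamiltonian with chemical potential, `𝓗^N = H^N + μ ∑ₖ σ_z⁽ᵏ⁾`. -/
def bcsHmu (ε Tc μ : ℝ) (N : ℕ) : Op N :=
  bcsH ε Tc N + (μ : ℂ) • ∑ k : Fin N, siteOp k pauliZ

/-- The Gibbs density matrix `exp(-β H^N) / Tr exp(-β H^N)`. -/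
def gibbs (β ε Tc : ℝ) (N : ℕ) : Op N :=
  (Matrix.trace (NormedSpace.exp (-(β : ℂ) • bcsH ε Tc N)))⁻¹ •
    NormedSpace.exp (-(β : ℂ) • bcsH ε Tc N)

/-- The gap (order parameter) `Δ > 0` of the superconducting phase: a positive solution of the
consistency condition `ω / Tc = tanh (β ω)`, `ω = √(ε² + 4 Tc² Δ²)`. -/
def IsGap (β ε Tc Δ : ℝ) : Prop :=
  0 < Δ ∧ Real.sqrt (ε ^ 2 + 4 * Tc ^ 2 * Δ ^ 2) / Tc =
    Real.tanh (β * Real.sqrt (ε ^ 2 + 4 * Tc ^ 2 * Δ ^ 2))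

/-! ### The GNS vector -/

/-- An orthonormal basis `|s, s_z⟩_α` of `(ℂ²)^{⊗N}` consisting of joint eigenvectors of the
Casimir operator (eigenvalue `s (s + 1)`, `s ≥ 0`) and of `Sz` (eigenvalue `s_z`). The triples
`(s, s_z, α)` are enumerated by a type with `2 ^ N` elements. -/
structure SpinBasis (N : ℕ) where
  vec : OrthonormalBasis (Conf N) ℂ (EuclideanSpace ℂ (Conf N))
  s : Conf N → ℝ
  sz : Conf N → ℝ
  s_nonneg : ∀ i, 0 ≤ s i
  casimir_vec : ∀ i, casimir N *ᵥ (vec i).ofLp = ((s i * (s i + 1) : ℝ) : ℂ) • (vec i).ofLp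
  sz_vec : ∀ i, Sz N *ᵥ (vec i).ofLp = ((sz i : ℝ) : ℂ) • (vec i).ofLp

theorem siteOp_mulVec {N : ℕ} (k : Fin N) (A : Matrix (Fin 2) (Fin 2) ℂ) (v : Conf N → ℂ)
    (x : Conf N) : (siteOp k A *ᵥ v) x = ∑ a, A (x k) a * v (Function.update x k a) := by
  have key : ∀ y : Conf N, (∀ j, j ≠ k → x j = y j) ↔ y = Function.update x k (y k) := by
    intro y
    constructor
    · intro h
      funext j
      by_cases hj : j = k
      · subst hj; simp
      · simp [hj, h j hj]
    · intro h j hj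
      rw [h]; simp [hj]
  simp only [Matrix.mulVec, dotProduct, siteOp, ite_mul, zero_mul]
  rw [← Finset.sum_filter]
  symm
  refine Finset.sum_bij (fun a _ => Function.update x k a) ?_ ?_ ?_ ?_
  · intro a _
    simp only [Finset.mem_filter, Finset.mem_univ, true_and]
    intro j hj; simp [hj]
  · intro a _ b _ h
    have := congrFun h k
    simpa using this
  · intro y hy
    simp only [Finset.mem_filter, Finset.mem_univ, true_and] at hy
    exact ⟨y k, Finset.mem_univ _, ((key y).1 hy).symm⟩
  · intro a _
    simp

theorem op_ext {N : ℕ} {A B : Op N} (h : ∀ v x, (A *ᵥ v) x = (B *ᵥ v) x) : A = B :=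
  Matrix.mulVec_injective (funext fun v => funext fun x => h v x)

theorem siteOp_mul_self {N : ℕ} (k : Fin N) (A B : Matrix (Fin 2) (Fin 2) ℂ) :
    siteOp k A * siteOp k B = siteOp k (A * B) := by
  apply op_ext
  intro v x
  simp only [← Matrix.mulVec_mulVec, siteOp_mulVec, Function.update_self, Function.update_idem,
    Matrix.mul_apply, Finset.mul_sum, Finset.sum_mul]
  rw [Finset.sum_comm]
  simp only [mul_assoc]

theorem siteOp_comm {N : ℕ} {j k : Fin N} (h : j ≠ k) (A B : Matrix (Fin 2) (Fin 2) ℂ) :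
    siteOp j A * siteOp k B = siteOp k B * siteOp j A := by
  apply op_ext
  intro v x
  simp only [← Matrix.mulVec_mulVec, siteOp_mulVec, Function.update_of_ne h,
    Function.update_of_ne h.symm, Finset.mul_sum]
  rw [Finset.sum_comm]
  refine Finset.sum_congr rfl fun a _ => Finset.sum_congr rfl fun b _ => ?_
  rw [Function.update_comm h]
  ring

theorem siteOp_sub {N : ℕ} (k : Fin N) (A B : Matrix (Fin 2) (Fin 2) ℂ) :
    siteOp k (A - B) = siteOp k A - siteOp k B := by
  ext x y
  simp only [siteOp, Matrix.sub_apply]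
  split_ifs <;> simp

theorem siteOp_smul {N : ℕ} (k : Fin N) (c : ℂ) (A : Matrix (Fin 2) (Fin 2) ℂ) :
    siteOp k (c • A) = c • siteOp k A := by
  ext x y
  simp only [siteOp, Matrix.smul_apply]
  split_ifs <;> simp

theorem collective_comm {N : ℕ} {A B C : Matrix (Fin 2) (Fin 2) ℂ} {c : ℂ}
    (h : A * B - B * A = (2 * c) • C) :
    collective N A * collective N B - collective N B * collective N A = c • collective N C := by
  have key : (∑ k : Fin N, siteOp k A) * (∑ k : Fin N, siteOp k B) -
      (∑ k : Fin N, siteOp k B) * (∑ k : Fin N, siteOp k A) =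
        (2 * c) • ∑ k : Fin N, siteOp k C := by
    rw [Finset.sum_mul_sum, Finset.sum_mul_sum, Finset.sum_comm (f := fun i j =>
      siteOp i B * siteOp j A), ← Finset.sum_sub_distrib, Finset.smul_sum]
    refine Finset.sum_congr rfl fun i _ => ?_
    rw [← Finset.sum_sub_distrib, Finset.sum_eq_single i]
    · rw [siteOp_mul_self, siteOp_mul_self, ← siteOp_sub, h, siteOp_smul]
    · intro j _ hj
      rw [siteOp_comm hj.symm, sub_self]
    · simp
  simp only [collective, smul_mul_assoc, mul_smul_comm, ← smul_sub, key]
  simp only [smul_smul]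
  congr 1
  ring

theorem collective_isHermitian (N : ℕ) {A : Matrix (Fin 2) (Fin 2) ℂ} (h : A.IsHermitian) :
    (collective N A).IsHermitian := by
  ext x y
  simp only [collective, Matrix.conjTranspose_apply, Matrix.smul_apply, Matrix.sum_apply, siteOp,
    smul_eq_mul, star_mul', star_sum]
  congr 1
  · simp
  · refine Finset.sum_congr rfl fun k _ => ?_
    have e : (∀ j, j ≠ k → y j = x j) ↔ (∀ j, j ≠ k → x j = y j) :=
      forall_congr' fun j => imp_congr_right fun _ => eq_comm
    simp only [e]
    split_ifs
    · exact h.apply _ _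
    · simp

theorem pauliX_isHermitian : pauliX.IsHermitian := by
  ext i j; fin_cases i <;> fin_cases j <;> simp [pauliX]

theorem pauliY_isHermitian : pauliY.IsHermitian := by
  ext i j; fin_cases i <;> fin_cases j <;> simp [pauliY]

theorem pauliZ_isHermitian : pauliZ.IsHermitian := by
  ext i j; fin_cases i <;> fin_cases j <;> simp [pauliZ]

theorem comm_xz (N : ℕ) : Sx N * Sz N - Sz N * Sx N = (-Complex.I) • Sy N := by
  apply collective_comm
  ext i j
  fin_cases i <;> fin_cases j <;> simp [pauliX, pauliY, pauliZ, mul_assoc] <;> norm_num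

theorem comm_yz (N : ℕ) : Sy N * Sz N - Sz N * Sy N = Complex.I • Sx N := by
  apply collective_comm
  ext i j
  fin_cases i <;> fin_cases j <;> simp [pauliX, pauliY, pauliZ] <;> ring

theorem casimir_comm_Sz (N : ℕ) : Commute (casimir N) (Sz N) := by
  have hx := comm_xz N
  have hy := comm_yz N
  unfold casimir
  rw [commute_iff_eq, ← sub_eq_zero]
  have : (Sx N * Sx N + Sy N * Sy N + Sz N * Sz N) * Sz N
      - Sz N * (Sx N * Sx N + Sy N * Sy N + Sz N * Sz N) =
      Sx N * (Sx N * Sz N - Sz N * Sx N) + (Sx N * Sz N - Sz N * Sx N) * Sx N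
      + (Sy N * (Sy N * Sz N - Sz N * Sy N) + (Sy N * Sz N - Sz N * Sy N) * Sy N) := by
    noncomm_ring
  rw [this, hx, hy]
  simp only [mul_smul_comm, smul_mul_assoc, neg_smul, mul_neg, neg_mul]
  abel

open scoped ComplexOrder in
theorem casimir_posSemidef (N : ℕ) : (casimir N).PosSemidef := by
  have key : ∀ {A : Matrix (Fin 2) (Fin 2) ℂ}, A.IsHermitian →
      (collective N A * collective N A).PosSemidef := by
    intro A hA
    have := Matrix.posSemidef_conjTranspose_mul_self (collective N A)
    rwa [(collective_isHermitian N hA).eq] at this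
  exact ((key pauliX_isHermitian).add (key pauliY_isHermitian)).add (key pauliZ_isHermitian)

open scoped ComplexOrder in
/-- Bases `|s, s_z⟩_α` exist. -/
instance spinBasis_nonempty (N : ℕ) : Nonempty (SpinBasis N) := by
  classical
  set E := EuclideanSpace ℂ (Conf N) with hE
  let A : E →ₗ[ℂ] E := Matrix.toEuclideanLin (casimir N)
  let B : E →ₗ[ℂ] E := Matrix.toEuclideanLin (Sz N)
  have hAv : ∀ v, (A v).ofLp = casimir N *ᵥ v.ofLp := fun _ => rfl
  have hBv : ∀ v, (B v).ofLp = Sz N *ᵥ v.ofLp := fun _ => rfl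
  have hA : A.IsSymmetric := Matrix.isSymmetric_toEuclideanLin_iff.2 (casimir_posSemidef N).1
  have hB : B.IsSymmetric :=
    Matrix.isSymmetric_toEuclideanLin_iff.2 (collective_isHermitian N pauliZ_isHermitian)
  have hAB : Commute A B := by
    have h := (casimir_comm_Sz N).eq
    apply LinearMap.ext
    intro v
    apply (WithLp.ofLp_injective 2)
    rw [Module.End.mul_apply, Module.End.mul_apply, hAv, hBv, hBv, hAv, Matrix.mulVec_mulVec,
      Matrix.mulVec_mulVec, h]
  have hint := LinearMap.IsSymmetric.directSum_isInternal_of_commute hA hB hAB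
  have hfam := LinearMap.IsSymmetric.orthogonalFamily_eigenspace_inf_eigenspace hA hB
  set V : ℂ × ℂ → Submodule ℂ E :=
    fun i => Module.End.eigenspace A i.2 ⊓ Module.End.eigenspace B i.1 with hV
  have hfin : {i | V i ≠ ⊥}.Finite :=
    WellFoundedGT.finite_ne_bot_of_iSupIndep hint.submodule_iSupIndep
  have : Fintype {i // V i ≠ ⊥} := hfin.fintype
  have hint' : DirectSum.IsInternal (fun i : {i // V i ≠ ⊥} => V i) :=
    (DirectSum.isInternal_ne_bot_iff).2 hint
  have hfam' : OrthogonalFamily ℂ (fun i : {i // V i ≠ ⊥} => V i)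
      fun i => (V i).subtypeₗᵢ := hfam.comp Subtype.val_injective
  have hn : Module.finrank ℂ E = Fintype.card (Conf N) := finrank_euclideanSpace
  let e := hint'.subordinateOrthonormalBasis hn hfam'
  let b := e.reindex (Fintype.equivFin (Conf N)).symm
  have hb : ∀ i, ∃ p : ℂ × ℂ, b i ∈ V p := by
    intro i
    refine ⟨(hint'.subordinateOrthonormalBasisIndex hn (Fintype.equivFin (Conf N) i) hfam').1, ?_⟩
    simp only [b, OrthonormalBasis.reindex_apply]
    exact hint'.subordinateOrthonormalBasis_subordinate hn _ hfam'
  have hne : ∀ i, b i ≠ 0 := fun i => b.orthonormal.ne_zero i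
  have key : ∀ i, ∃ q : ℝ × ℝ, 0 ≤ q.1 ∧ A (b i) = ((q.1 * (q.1 + 1) : ℝ) : ℂ) • b i ∧
      B (b i) = ((q.2 : ℝ) : ℂ) • b i := by
    intro i
    obtain ⟨⟨l, k⟩, hp⟩ := hb i
    obtain ⟨hk, hl⟩ := hp
    have hk' : Module.End.HasEigenvalue A k := Module.End.hasEigenvalue_of_hasEigenvector ⟨hk, hne i⟩
    have hl' : Module.End.HasEigenvalue B l := Module.End.hasEigenvalue_of_hasEigenvector ⟨hl, hne i⟩
    have hk0 : A (b i) = k • b i := Module.End.mem_eigenspace_iff.1 hk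
    have hl0 : B (b i) = l • b i := Module.End.mem_eigenspace_iff.1 hl
    have hkr : ((k.re : ℝ) : ℂ) = k := Complex.conj_eq_iff_re.1 (hA.conj_eigenvalue_eq_self hk')
    have hlr : ((l.re : ℝ) : ℂ) = l := Complex.conj_eq_iff_re.1 (hB.conj_eigenvalue_eq_self hl')
    have hkpos : 0 ≤ k.re := by
      have h1 := (casimir_posSemidef N).dotProduct_mulVec_nonneg (b i).ofLp
      have h2 : casimir N *ᵥ (b i).ofLp = k • (b i).ofLp := by
        have := congrArg WithLp.ofLp hk0
        rwa [hAv] at this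
      have h3 : star (b i).ofLp ⬝ᵥ (b i).ofLp = 1 := by
        have := (EuclideanSpace.inner_eq_star_dotProduct (b i) (b i))
        rw [dotProduct_comm, ← this, inner_self_eq_norm_sq_to_K, b.orthonormal.1 i]
        simp
      rw [h2, dotProduct_smul, h3, smul_eq_mul, mul_one] at h1
      exact (Complex.le_def.1 h1).1
    refine ⟨((Real.sqrt (1 + 4 * k.re) - 1) / 2, l.re), ?_, ?_, ?_⟩
    · have : 1 ≤ Real.sqrt (1 + 4 * k.re) := Real.one_le_sqrt.2 (by linarith)
      simp only
      linarith
    · have hs := Real.sq_sqrt (show (0 : ℝ) ≤ 1 + 4 * k.re by linarith)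
      have : (Real.sqrt (1 + 4 * k.re) - 1) / 2 * ((Real.sqrt (1 + 4 * k.re) - 1) / 2 + 1)
          = k.re := by nlinarith
      simp only [this, hkr, hk0]
    · simp only [hlr, hl0]
  choose q hq0 hqA hqB using key
  refine ⟨⟨b, fun i => (q i).1, fun i => (q i).2, hq0, fun i => ?_, fun i => ?_⟩⟩
  · have := congrArg WithLp.ofLp (hqA i)
    rwa [hAv] at this
  · have := congrArg WithLp.ofLp (hqB i)
    rwa [hBv] at this

/-- The eigenvalues `η(s, s_z)` of `H^N`. -/
def eta (ε Tc : ℝ) (N : ℕ) (s sz : ℝ) : ℝ :=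
  -2 * ε * sz - 2 * Tc / N * (s * (s + 1) - sz * (sz - 1))

/-- The Boltzmann weights. -/
def weight (β ε Tc : ℝ) {N : ℕ} (b : SpinBasis N) (i : Conf N) : ℝ :=
  Real.exp (-β * eta ε Tc N (b.s i) (b.sz i)) /
    ∑ j, Real.exp (-β * eta ε Tc N (b.s j) (b.sz j))

/-- The purified Gibbs vector `Ω_β^N = ∑ √ρ(s, s_z) |s, s_z⟩_α ⊗ |s, s_z⟩_α`. -/
def gnsVec (β ε Tc : ℝ) {N : ℕ} (b : SpinBasis N) : Conf N × Conf N → ℂ :=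
  fun p => ∑ i, (Real.sqrt (weight β ε Tc b i) : ℂ) * ((b.vec i).ofLp p.1 * (b.vec i).ofLp p.2)

/-- The expectation `⟨Ω_β^N | X | Ω_β^N⟩`. -/
def gnsExp (β ε Tc : ℝ) {N : ℕ} (b : SpinBasis N) (X : Op2 N) : ℂ :=
  star (gnsVec β ε Tc b) ⬝ᵥ (X *ᵥ gnsVec β ε Tc b)

/-- `E₊^N = (S₊ ⊗ I) / (c N)`. -/
def Ep (c : ℝ) (N : ℕ) : Op2 N := ((c * N : ℝ) : ℂ)⁻¹ • (Sp N ⊗ₖ (1 : Op N))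

/-- `E₋^N = (S₋ ⊗ I) / (c N)`. -/
def Em (c : ℝ) (N : ℕ) : Op2 N := ((c * N : ℝ) : ℂ)⁻¹ • (Sm N ⊗ₖ (1 : Op N))

/-- The time evolution `exp (-i t (K ⊗ I - I ⊗ K))` in the GNS representation generated by the
Hamiltonian `K`. -/
def gnsEvol {N : ℕ} (K : Op N) (t : ℝ) : Op2 N :=
  NormedSpace.exp ((-(Complex.I * (t : ℂ))) • (K ⊗ₖ (1 : Op N) - (1 : Op N) ⊗ₖ K))

/-! ### The Heisenberg algebra on the circle -/

instance factTwoPiPos : Fact (0 < 2 * Real.pi) := ⟨Real.two_pi_pos⟩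

/-- Square-integrable `2π`-periodic functions, with the normalised measure `dφ / 2π` (so that the
constant function `1` and the plane waves `e^{inφ}` are unit vectors). -/
abbrev CircleL2 : Type :=
  Lp ℂ 2 (AddCircle.haarAddCircle : Measure (AddCircle (2 * Real.pi)))

/-- The plane wave `|n⟩ = e^{inφ}`. -/
def planeWave (n : ℤ) : CircleL2 := fourierLp 2 n

/-- The Weyl operator `e^{iα p̂}`: `(e^{iα p̂} ψ)(φ) = ψ(φ + α)`. -/
def expMomentum (α : ℝ) : CircleL2 →L[ℂ] CircleL2 :=
  (Lp.compMeasurePreservingₗᵢ ℂ (fun φ : AddCircle (2 * Real.pi) => φ + (α : AddCircle (2 * Real.pi)))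
    (measurePreserving_add_right _ _)).toContinuousLinearMap

/-- The Weyl operator `e^{inφ̂}`: multiplication by `e^{inφ}`. -/
def expAngle (n : ℤ) : CircleL2 →L[ℂ] CircleL2 :=
  (ContinuousLinearMap.mul ℂ ℂ).holderL AddCircle.haarAddCircle ⊤ 2 2 (fourierLp ⊤ n)

/-- `e^{iα p̂} |n⟩ = e^{iαn} |n⟩`, in accordance with `p̂ |n⟩ = n |n⟩`. -/
theorem expMomentum_planeWave (α : ℝ) (n : ℤ) :
    expMomentum α (planeWave n) = Complex.exp (Complex.I * α * n) • planeWave n := by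
  apply Lp.ext
  have h1 := Lp.coeFn_compMeasurePreserving (planeWave n)
    (measurePreserving_add_right (AddCircle.haarAddCircle : Measure (AddCircle (2 * Real.pi)))
      (α : AddCircle (2 * Real.pi)))
  have h2 : ⇑(planeWave n) =ᵐ[AddCircle.haarAddCircle] ⇑(fourier (T := 2 * Real.pi) n) :=
    coeFn_fourierLp 2 n
  have h3 := (measurePreserving_add_right
    (AddCircle.haarAddCircle : Measure (AddCircle (2 * Real.pi)))
      (α : AddCircle (2 * Real.pi))).quasiMeasurePreserving.ae_eq_comp h2
  have h4 := Lp.coeFn_smul (Complex.exp (Complex.I * α * n)) (planeWave n)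
  refine h1.trans (h3.trans ?_)
  filter_upwards [h4, h2] with x hx4 hx2
  rw [hx4, Pi.smul_apply, hx2]
  simp only [Function.comp_apply, smul_eq_mul]
  rw [fourier_apply, fourier_apply, smul_add, AddCircle.toCircle_add, Circle.coe_mul, mul_comm,
    ← fourier_apply, fourier_coe_apply]
  congr 2
  push_cast
  have : (Real.pi : ℂ) ≠ 0 := by exact_mod_cast Real.pi_ne_zero
  field_simp

theorem expAngle_planeWave (n m : ℤ) : expAngle n (planeWave m) = planeWave (n + m) := by
  apply Lp.ext
  have h1 : ⇑(expAngle n (planeWave m)) =ᵐ[AddCircle.haarAddCircle] _ :=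
    ContinuousLinearMap.coeFn_holder (r := 2) (ContinuousLinearMap.mul ℂ ℂ)
      (fourierLp (T := 2 * Real.pi) ⊤ n) (planeWave m)
  have h2 : ⇑(planeWave m) =ᵐ[AddCircle.haarAddCircle] ⇑(fourier (T := 2 * Real.pi) m) :=
    coeFn_fourierLp 2 m
  have h3 := coeFn_fourierLp (T := 2 * Real.pi) ⊤ n
  have h4 : ⇑(planeWave (n + m)) =ᵐ[AddCircle.haarAddCircle]
    ⇑(fourier (T := 2 * Real.pi) (n + m)) := coeFn_fourierLp 2 (n + m)
  filter_upwards [h1, h2, h3, h4] with x hx1 hx2 hx3 hx4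
  rw [hx1, hx2, hx3, hx4, fourier_add]
  rfl

/-- The vacuum state `Ω(X) = ⟨0 | X | 0⟩`. -/
def vacState (X : CircleL2 →L[ℂ] CircleL2) : ℂ := inner ℂ (planeWave 0) (X (planeWave 0))

/-- The mesoscopic limit: for all `n, n', m, m'`,
`⟨E₋ⁿ E₊ⁿ' X^N E₊ᵐ E₋ᵐ'⟩_β^N ⟶ Ω(e^{-i(n-n')φ̂} X e^{i(m-m')φ̂})` as `N → ∞`. -/
def MesoLimit (β ε Tc c : ℝ) (b : ∀ N, SpinBasis N) (X : ∀ N, Op2 N)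
    (Y : CircleL2 →L[ℂ] CircleL2) : Prop :=
  ∀ n n' m m' : ℕ,
    Tendsto
      (fun N => gnsExp β ε Tc (b N)
        (Em c N ^ n * Ep c N ^ n' * X N * Ep c N ^ m * Em c N ^ m'))
      atTop
      (𝓝 (vacState (expAngle (-((n : ℤ) - n')) ∘L Y ∘L expAngle ((m : ℤ) - m'))))

end MesoBCS

end

noncomputable section

namespace MesoBCS

theorem comm_xy (N : ℕ) : Sx N * Sy N - Sy N * Sx N = Complex.I • Sz N := by
  apply collective_comm
  ext i j
  fin_cases i <;> fin_cases j <;> simp [pauliX, pauliY, pauliZ] <;> ring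

theorem Sz_mul_Sp (N : ℕ) : Sz N * Sp N = Sp N * Sz N + Sp N := by
  have hx := sub_eq_iff_eq_add.1 (comm_xz N)
  have hy := sub_eq_iff_eq_add.1 (comm_yz N)
  simp only [Sp, mul_add, add_mul, mul_smul_comm, smul_mul_assoc, hx, hy, smul_add, smul_smul,
    Complex.I_mul_I]
  module

theorem Sz_mul_Sm (N : ℕ) : Sz N * Sm N = Sm N * Sz N - Sm N := by
  have hx := sub_eq_iff_eq_add.1 (comm_xz N)
  have hy := sub_eq_iff_eq_add.1 (comm_yz N)
  simp only [Sm, mul_sub, sub_mul, mul_smul_comm, smul_mul_assoc, hx, hy, smul_add, smul_smul,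
    Complex.I_mul_I]
  module

theorem Sp_mul_Sm (N : ℕ) : Sp N * Sm N = casimir N - Sz N * Sz N + Sz N := by
  have hx := sub_eq_iff_eq_add.1 (comm_xy N)
  simp only [Sp, Sm, casimir, mul_sub, add_mul, mul_smul_comm, smul_mul_assoc, hx, smul_add,
    smul_smul, Complex.I_mul_I]
  module

theorem Sm_mul_Sp (N : ℕ) : Sm N * Sp N = casimir N - Sz N * Sz N - Sz N := by
  have hx := sub_eq_iff_eq_add.1 (comm_xy N)
  simp only [Sp, Sm, casimir, sub_mul, mul_add, mul_smul_comm, smul_mul_assoc, hx]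
  match_scalars <;> simp

theorem casimir_mul_Sp (N : ℕ) : casimir N * Sp N = Sp N * casimir N := by
  have h1 : casimir N = Sp N * Sm N + Sz N * Sz N - Sz N := by rw [Sp_mul_Sm]; abel
  have h2 : casimir N = Sm N * Sp N + Sz N * Sz N + Sz N := by rw [Sm_mul_Sp]; abel
  calc casimir N * Sp N = Sp N * (Sm N * Sp N) + Sz N * (Sz N * Sp N) - Sz N * Sp N := by
        rw [h1]; noncomm_ring
    _ = Sp N * (Sm N * Sp N + Sz N * Sz N + Sz N) := by
        simp only [Sz_mul_Sp, mul_add, ← mul_assoc, add_mul]; abel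
    _ = _ := by rw [← h2]

theorem casimir_mul_Sm (N : ℕ) : casimir N * Sm N = Sm N * casimir N := by
  have h1 : casimir N = Sp N * Sm N + Sz N * Sz N - Sz N := by rw [Sp_mul_Sm]; abel
  have h2 : casimir N = Sm N * Sp N + Sz N * Sz N + Sz N := by rw [Sm_mul_Sp]; abel
  calc casimir N * Sm N = Sm N * (Sp N * Sm N) + Sz N * (Sz N * Sm N) + Sz N * Sm N := by
        rw [h2]; noncomm_ring
    _ = Sm N * (Sp N * Sm N + Sz N * Sz N - Sz N) := by
        simp only [Sz_mul_Sm, mul_add, mul_sub, ← mul_assoc, sub_mul]; abel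
    _ = _ := by rw [← h1]

theorem Sp_conjTranspose (N : ℕ) : (Sp N)ᴴ = Sm N := by
  simp [Sp, Sm, Sx, Sy, Matrix.conjTranspose_add, Matrix.conjTranspose_smul,
    (collective_isHermitian N pauliX_isHermitian).eq,
    (collective_isHermitian N pauliY_isHermitian).eq, sub_eq_add_neg]

theorem Sm_conjTranspose (N : ℕ) : (Sm N)ᴴ = Sp N := by
  rw [← Sp_conjTranspose, Matrix.conjTranspose_conjTranspose]

theorem Sz_isHermitian {N : ℕ} : (Sz N).IsHermitian :=
  collective_isHermitian N pauliZ_isHermitian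

theorem star_mulVec_dotProduct {n : Type*} [Fintype n] (A : Matrix n n ℂ) (u v : n → ℂ) :
    star (A *ᵥ u) ⬝ᵥ v = star u ⬝ᵥ (Aᴴ *ᵥ v) := by
  rw [Matrix.star_mulVec, Matrix.dotProduct_mulVec]

/-! ### Joint eigenvectors -/

/-- `v` satisfies the eigenvector equations of `S²` and `Sz` with eigenvalues `c` and `z`. -/
structure IsJoint {N : ℕ} (c z : ℝ) (v : Conf N → ℂ) : Prop where
  casimir_eq : casimir N *ᵥ v = (c : ℂ) • v
  sz_eq : Sz N *ᵥ v = (z : ℂ) • v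

namespace IsJoint

variable {N : ℕ} {c z : ℝ} {v : Conf N → ℂ}

theorem raise (h : IsJoint c z v) : IsJoint c (z + 1) (Sp N *ᵥ v) where
  casimir_eq := by
    rw [Matrix.mulVec_mulVec, casimir_mul_Sp, ← Matrix.mulVec_mulVec, h.casimir_eq,
      Matrix.mulVec_smul]
  sz_eq := by
    rw [Matrix.mulVec_mulVec, Sz_mul_Sp, Matrix.add_mulVec, ← Matrix.mulVec_mulVec, h.sz_eq,
      Matrix.mulVec_smul]
    push_cast; module

theorem lower (h : IsJoint c z v) : IsJoint c (z - 1) (Sm N *ᵥ v) where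
  casimir_eq := by
    rw [Matrix.mulVec_mulVec, casimir_mul_Sm, ← Matrix.mulVec_mulVec, h.casimir_eq,
      Matrix.mulVec_smul]
  sz_eq := by
    rw [Matrix.mulVec_mulVec, Sz_mul_Sm, Matrix.sub_mulVec, ← Matrix.mulVec_mulVec, h.sz_eq,
      Matrix.mulVec_smul]
    push_cast; module

theorem raise_pow (h : IsJoint c z v) (l : ℕ) : IsJoint c (z + l) (Sp N ^ l *ᵥ v) := by
  induction l with
  | zero => simpa using h
  | succ l ih =>
    rw [pow_succ', ← Matrix.mulVec_mulVec]
    have := ih.raise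
    push_cast
    rwa [← add_assoc]

theorem lower_pow (h : IsJoint c z v) (l : ℕ) : IsJoint c (z - l) (Sm N ^ l *ᵥ v) := by
  induction l with
  | zero => simpa using h
  | succ l ih =>
    rw [pow_succ', ← Matrix.mulVec_mulVec]
    have := ih.lower
    push_cast
    rwa [← sub_sub]

theorem Sp_Sm (h : IsJoint c z v) :
    (Sp N * Sm N) *ᵥ v = ((c - z ^ 2 + z : ℝ) : ℂ) • v := by
  rw [Sp_mul_Sm, Matrix.add_mulVec, Matrix.sub_mulVec, ← Matrix.mulVec_mulVec, h.sz_eq,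
    Matrix.mulVec_smul, h.sz_eq, h.casimir_eq]
  push_cast; module

theorem Sm_Sp (h : IsJoint c z v) :
    (Sm N * Sp N) *ᵥ v = ((c - z ^ 2 - z : ℝ) : ℂ) • v := by
  rw [Sm_mul_Sp, Matrix.sub_mulVec, Matrix.sub_mulVec, ← Matrix.mulVec_mulVec, h.sz_eq,
    Matrix.mulVec_smul, h.sz_eq, h.casimir_eq]
  push_cast; module

theorem Sp_pow_Sm_pow (h : IsJoint c z v) (l : ℕ) :
    (Sp N ^ l * Sm N ^ l) *ᵥ v =
      ((∏ k ∈ Finset.range l, (c - (z - k) ^ 2 + (z - k)) : ℝ) : ℂ) • v := by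
  induction l with
  | zero => simp
  | succ l ih =>
    have e : Sp N ^ (l + 1) * Sm N ^ (l + 1) = Sp N ^ l * ((Sp N * Sm N) * Sm N ^ l) := by
      rw [pow_succ, pow_succ']; simp only [mul_assoc]
    rw [e, ← Matrix.mulVec_mulVec, ← Matrix.mulVec_mulVec, (h.lower_pow l).Sp_Sm,
      Matrix.mulVec_smul, Matrix.mulVec_mulVec, ih, smul_smul, Finset.prod_range_succ, mul_comm]
    push_cast; rfl

theorem Sm_pow_Sp_pow (h : IsJoint c z v) (l : ℕ) :
    (Sm N ^ l * Sp N ^ l) *ᵥ v =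
      ((∏ k ∈ Finset.range l, (c - (z + k) ^ 2 - (z + k)) : ℝ) : ℂ) • v := by
  induction l with
  | zero => simp
  | succ l ih =>
    have e : Sm N ^ (l + 1) * Sp N ^ (l + 1) = Sm N ^ l * ((Sm N * Sp N) * Sp N ^ l) := by
      rw [pow_succ, pow_succ']; simp only [mul_assoc]
    rw [e, ← Matrix.mulVec_mulVec, ← Matrix.mulVec_mulVec, (h.raise_pow l).Sm_Sp,
      Matrix.mulVec_smul, Matrix.mulVec_mulVec, ih, smul_smul, Finset.prod_range_succ, mul_comm]
    push_cast; rfl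

theorem dotProduct_eq_zero_of_sz (h : IsJoint c z v) {c' z' : ℝ} {u : Conf N → ℂ}
    (hu : IsJoint c' z' u) (hz : z ≠ z') : star v ⬝ᵥ u = 0 := by
  have e := star_mulVec_dotProduct (Sz N) v u
  rw [Sz_isHermitian.eq, h.sz_eq, hu.sz_eq,
    star_smul, smul_dotProduct, dotProduct_smul] at e
  have e' : ((z : ℂ) - z') * (star v ⬝ᵥ u) = 0 := by
    simp only [smul_eq_mul, Complex.star_def, Complex.conj_ofReal] at e
    rw [sub_mul, e, sub_self]
  refine (mul_eq_zero.1 e').resolve_left fun h0 => hz ?_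
  exact_mod_cast sub_eq_zero.1 h0

theorem dotProduct_eq_zero_of_casimir (h : IsJoint c z v) {c' z' : ℝ} {u : Conf N → ℂ}
    (hu : IsJoint c' z' u) (hc : c ≠ c') : star v ⬝ᵥ u = 0 := by
  have e := star_mulVec_dotProduct (casimir N) v u
  rw [(casimir_posSemidef N).1.eq, h.casimir_eq, hu.casimir_eq,
    star_smul, smul_dotProduct, dotProduct_smul] at e
  have e' : ((c : ℂ) - c') * (star v ⬝ᵥ u) = 0 := by
    simp only [smul_eq_mul, Complex.star_def, Complex.conj_ofReal] at e
    rw [sub_mul, e, sub_self]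
  refine (mul_eq_zero.1 e').resolve_left fun h0 => hc ?_
  exact_mod_cast sub_eq_zero.1 h0

theorem bcsH_mulVec (h : IsJoint c z v) (ε Tc : ℝ) :
    bcsH ε Tc N *ᵥ v = ((-2 * ε * z - 2 * Tc / N * (c - z * (z - 1)) : ℝ) : ℂ) • v := by
  rw [bcsH, Matrix.sub_mulVec, Matrix.smul_mulVec, Matrix.smul_mulVec, h.Sp_Sm, h.sz_eq]
  push_cast; module

theorem bcsHmu_mulVec (h : IsJoint c z v) (ε Tc μ : ℝ) :
    bcsHmu ε Tc μ N *ᵥ v =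
      ((-2 * ε * z - 2 * Tc / N * (c - z * (z - 1)) + 2 * μ * z : ℝ) : ℂ) • v := by
  have e : (∑ k : Fin N, siteOp k pauliZ : Op N) = (2 : ℂ) • Sz N := by
    simp [Sz, collective, smul_smul]
  rw [bcsHmu, Matrix.add_mulVec, h.bcsH_mulVec, Matrix.smul_mulVec, e, Matrix.smul_mulVec,
    h.sz_eq]
  push_cast; module

end IsJoint

theorem bcsHmu_zero (ε Tc : ℝ) (N : ℕ) : bcsHmu ε Tc 0 N = bcsH ε Tc N := by simp [bcsHmu]

theorem SpinBasis.isJoint {N : ℕ} (b : SpinBasis N) (i : Conf N) :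
    IsJoint (b.s i * (b.s i + 1)) (b.sz i) (b.vec i).ofLp := ⟨b.casimir_vec i, b.sz_vec i⟩

theorem SpinBasis.dotProduct_vec {N : ℕ} (b : SpinBasis N) (i j : Conf N) :
    star (b.vec i).ofLp ⬝ᵥ (b.vec j).ofLp = if i = j then 1 else 0 := by
  rw [← b.vec.inner_eq_ite i j, EuclideanSpace.inner_eq_star_dotProduct, dotProduct_comm]

/-! ### Matrix exponential on eigenvectors, and elementary tensors -/

theorem exp_mulVec_of_eigen {n : Type*} [Fintype n] [DecidableEq n] {A : Matrix n n ℂ}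
    {v : n → ℂ} {a : ℂ} (h : A *ᵥ v = a • v) :
    NormedSpace.exp A *ᵥ v = Complex.exp a • v := by
  have hp : ∀ k : ℕ, A ^ k *ᵥ v = a ^ k • v := by
    intro k
    induction k with
    | zero => simp
    | succ k ih => rw [pow_succ, ← Matrix.mulVec_mulVec, h, Matrix.mulVec_smul, ih, smul_smul,
        pow_succ']
  have hs : HasSum (fun k : ℕ => ((k.factorial : ℂ)⁻¹) • A ^ k) (NormedSpace.exp A) := by
    open scoped Matrix.Norms.Operator in
    exact NormedSpace.exp_series_hasSum_exp' (𝕂 := ℂ) A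
  have h1 := hs.map ((Matrix.mulVecBilin ℂ ℂ).flip v : Matrix n n ℂ →ₗ[ℂ] n → ℂ)
    (LinearMap.continuous_of_finiteDimensional _)
  have h2 : HasSum (fun k : ℕ => ((k.factorial : ℂ)⁻¹ • a ^ k) • v) (Complex.exp a • v) := by
    rw [Complex.exp_eq_exp_ℂ]
    exact (NormedSpace.exp_series_hasSum_exp' (𝕂 := ℂ) a).smul_const v
  refine h1.unique ?_
  convert h2 using 1
  funext k
  simp [hp, smul_smul]

/-- The elementary tensor `u ⊗ v`. -/
def tens {N : ℕ} (u v : Conf N → ℂ) : Conf N × Conf N → ℂ := fun p => u p.1 * v p.2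

theorem kronecker_mulVec_tens {N : ℕ} (A B : Op N) (u v : Conf N → ℂ) :
    (A ⊗ₖ B) *ᵥ tens u v = tens (A *ᵥ u) (B *ᵥ v) := by
  ext p
  simp only [Matrix.mulVec, dotProduct, tens, Fintype.sum_prod_type, Matrix.kroneckerMap_apply,
    Finset.sum_mul_sum]
  exact Finset.sum_congr rfl fun _ _ => Finset.sum_congr rfl fun _ _ => by ring

theorem star_tens_dotProduct {N : ℕ} (u v u' v' : Conf N → ℂ) :
    star (tens u v) ⬝ᵥ tens u' v' = (star u ⬝ᵥ u') * (star v ⬝ᵥ v') := by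
  simp only [dotProduct, tens, Fintype.sum_prod_type, Finset.sum_mul_sum, Pi.star_apply,
    star_mul']
  exact Finset.sum_congr rfl fun _ _ => Finset.sum_congr rfl fun _ _ => by ring

section

/-! ### Expectations in the GNS state as weighted averages -/

variable {N : ℕ}

theorem partition_pos (β ε Tc : ℝ) (b : SpinBasis N) :
    0 < ∑ j, Real.exp (-β * eta ε Tc N (b.s j) (b.sz j)) :=
  Finset.sum_pos (fun _ _ => Real.exp_pos _) Finset.univ_nonempty

theorem weight_nonneg (β ε Tc : ℝ) (b : SpinBasis N) (i : Conf N) : 0 ≤ weight β ε Tc b i :=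
  div_nonneg (Real.exp_pos _).le (partition_pos β ε Tc b).le

theorem sum_weight (β ε Tc : ℝ) (b : SpinBasis N) : ∑ i, weight β ε Tc b i = 1 := by
  simp only [weight, ← Finset.sum_div]
  exact div_self (partition_pos β ε Tc b).ne'

theorem gnsVec_eq (β ε Tc : ℝ) (b : SpinBasis N) :
    gnsVec β ε Tc b =
      ∑ i, (Real.sqrt (weight β ε Tc b i) : ℂ) • tens (b.vec i).ofLp (b.vec i).ofLp := by
  ext p
  simp [gnsVec, tens, Finset.sum_apply]

theorem tens_smul_left (a : ℂ) (u v : Conf N → ℂ) : tens (a • u) v = a • tens u v := by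
  ext p; simp [tens, mul_assoc]

theorem tens_smul_right (a : ℂ) (u v : Conf N → ℂ) : tens u (a • v) = a • tens u v := by
  ext p; simp only [tens, Pi.smul_apply, smul_eq_mul]; ring

theorem gnsEvol_mulVec_tens {K : Op N} {u v : Conf N → ℂ} {a b : ℝ} (hu : K *ᵥ u = (a : ℂ) • u)
    (hv : K *ᵥ v = (b : ℂ) • v) (t : ℝ) :
    gnsEvol K t *ᵥ tens u v = Complex.exp (((-(t * (a - b)) : ℝ) : ℂ) * Complex.I) • tens u v := by
  apply exp_mulVec_of_eigen
  rw [Matrix.smul_mulVec, Matrix.sub_mulVec, kronecker_mulVec_tens, kronecker_mulVec_tens, hu, hv,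
    Matrix.one_mulVec, Matrix.one_mulVec, tens_smul_left, tens_smul_right]
  push_cast; module

theorem gnsExp_evol (β ε Tc : ℝ) (b : SpinBasis N) (A B K : Op N) (t : ℝ) (e e' : Conf N → ℝ)
    (he : ∀ i, K *ᵥ (b.vec i).ofLp = (e i : ℂ) • (b.vec i).ofLp)
    (he' : ∀ i, K *ᵥ (B *ᵥ (b.vec i).ofLp) = (e' i : ℂ) • (B *ᵥ (b.vec i).ofLp)) :
    gnsExp β ε Tc b ((A ⊗ₖ (1 : Op N)) * gnsEvol K t * (B ⊗ₖ (1 : Op N))) =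
      ∑ i, (weight β ε Tc b i : ℂ) * (Complex.exp (((-(t * (e' i - e i)) : ℝ) : ℂ) * Complex.I) *
        (star (b.vec i).ofLp ⬝ᵥ ((A * B) *ᵥ (b.vec i).ofLp))) := by
  have h1 : ∀ i, ((A ⊗ₖ (1 : Op N)) * gnsEvol K t * (B ⊗ₖ (1 : Op N))) *ᵥ
      tens (b.vec i).ofLp (b.vec i).ofLp =
      Complex.exp (((-(t * (e' i - e i)) : ℝ) : ℂ) * Complex.I) •
        tens ((A * B) *ᵥ (b.vec i).ofLp) (b.vec i).ofLp := by
    intro i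
    rw [← Matrix.mulVec_mulVec, ← Matrix.mulVec_mulVec, kronecker_mulVec_tens, Matrix.one_mulVec,
      gnsEvol_mulVec_tens (he' i) (he i), Matrix.mulVec_smul, kronecker_mulVec_tens,
      Matrix.one_mulVec, Matrix.mulVec_mulVec]
  rw [gnsExp, gnsVec_eq, Matrix.mulVec_sum, star_sum, sum_dotProduct]
  refine Finset.sum_congr rfl fun i _ => ?_
  rw [dotProduct_sum, Finset.sum_eq_single i]
  · rw [Matrix.mulVec_smul, h1, star_smul, smul_dotProduct, dotProduct_smul, dotProduct_smul,
      star_tens_dotProduct, b.dotProduct_vec, if_pos rfl]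
    have : ((weight β ε Tc b i : ℝ) : ℂ) =
        (Real.sqrt (weight β ε Tc b i) : ℂ) * (Real.sqrt (weight β ε Tc b i) : ℂ) := by
      rw [← Complex.ofReal_mul, Real.mul_self_sqrt (weight_nonneg ..)]
    rw [this]
    simp only [smul_eq_mul, Complex.star_def, Complex.conj_ofReal]
    ring
  · intro j _ hj
    rw [Matrix.mulVec_smul, h1, star_smul, smul_dotProduct, dotProduct_smul, dotProduct_smul,
      star_tens_dotProduct, b.dotProduct_vec, if_neg hj.symm]
    simp
  · simp

theorem Ep_pow (c : ℝ) (m : ℕ) :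
    Ep c N ^ m = (((c * N : ℝ) : ℂ)⁻¹) ^ m • ((Sp N ^ m) ⊗ₖ (1 : Op N)) := by
  induction m with
  | zero => simp
  | succ m ih =>
    rw [pow_succ, ih, Ep, smul_mul_smul_comm, ← Matrix.mul_kronecker_mul, ← pow_succ, ← pow_succ,
      mul_one]

theorem Em_pow (c : ℝ) (m : ℕ) :
    Em c N ^ m = (((c * N : ℝ) : ℂ)⁻¹) ^ m • ((Sm N ^ m) ⊗ₖ (1 : Op N)) := by
  induction m with
  | zero => simp
  | succ m ih =>
    rw [pow_succ, ih, Em, smul_mul_smul_comm, ← Matrix.mul_kronecker_mul, ← pow_succ, ← pow_succ,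
      mul_one]

theorem meso_operator_eq (c : ℝ) (X : Op2 N) (n n' m m' : ℕ) :
    Em c N ^ n * Ep c N ^ n' * X * Ep c N ^ m * Em c N ^ m' =
      (((c * N : ℝ) : ℂ)⁻¹) ^ (n + n' + m + m') •
        (((Sm N ^ n * Sp N ^ n') ⊗ₖ (1 : Op N)) * X * ((Sp N ^ m * Sm N ^ m') ⊗ₖ (1 : Op N))) := by
  have h : ∀ A B : Op N, (A * B) ⊗ₖ (1 : Op N) = (A ⊗ₖ (1 : Op N)) * (B ⊗ₖ (1 : Op N)) := by
    intro A B
    rw [← Matrix.mul_kronecker_mul, mul_one]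
  rw [Ep_pow, Em_pow, Ep_pow, Em_pow, h, h]
  simp only [smul_mul_assoc, mul_smul_comm, smul_smul, mul_assoc]
  congr 1
  ring

theorem gnsExp_smul (β ε Tc : ℝ) (b : SpinBasis N) (a : ℂ) (X : Op2 N) :
    gnsExp β ε Tc b (a • X) = a * gnsExp β ε Tc b X := by
  rw [gnsExp, Matrix.smul_mulVec, dotProduct_smul, smul_eq_mul, gnsExp]

theorem IsJoint.dotProduct_ladder_of_ne {c z : ℝ} {v : Conf N → ℂ} (h : IsJoint c z v)
    {n n' m m' : ℕ} (hne : (m : ℤ) - m' ≠ (n : ℤ) - n') :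
    star v ⬝ᵥ ((Sm N ^ n * Sp N ^ n' * (Sp N ^ m * Sm N ^ m')) *ᵥ v) = 0 := by
  have e := (((h.lower_pow m').raise_pow m).raise_pow n').lower_pow n
  simp only [Matrix.mulVec_mulVec] at e
  simp only [mul_assoc] at e ⊢
  refine h.dotProduct_eq_zero_of_sz e fun h0 => hne ?_
  have : (m : ℝ) - m' = n - n' := by linarith
  exact_mod_cast this

theorem IsJoint.ladder_mulVec {c z : ℝ} {v : Conf N → ℂ} (h : IsJoint c z v)
    {n n' m m' : ℕ} (heq : (m : ℤ) - m' = (n : ℤ) - n') :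
    (Sm N ^ n * Sp N ^ n' * (Sp N ^ m * Sm N ^ m')) *ᵥ v =
      (((∏ k ∈ Finset.range n, (c - (z + k) ^ 2 - (z + k))) *
        ∏ k ∈ Finset.range m', (c - (z - k) ^ 2 + (z - k)) : ℝ) : ℂ) • v := by
  have e : Sm N ^ n * Sp N ^ n' * (Sp N ^ m * Sm N ^ m') =
      (Sm N ^ n * Sp N ^ n) * (Sp N ^ m' * Sm N ^ m') := by
    have : n' + m = n + m' := by omega
    rw [mul_assoc, ← mul_assoc (Sp N ^ n'), ← pow_add, this, pow_add]
    simp only [mul_assoc]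
  rw [e, ← Matrix.mulVec_mulVec, h.Sp_pow_Sm_pow, Matrix.mulVec_smul, h.Sm_pow_Sp_pow, smul_smul]
  push_cast
  rw [mul_comm]

theorem gnsExp_meso_of_ne (β ε Tc μ c t : ℝ) (b : SpinBasis N) {n n' m m' : ℕ}
    (hne : (m : ℤ) - m' ≠ (n : ℤ) - n') :
    gnsExp β ε Tc b (Em c N ^ n * Ep c N ^ n' * gnsEvol (bcsHmu ε Tc μ N) t * Ep c N ^ m *
      Em c N ^ m') = 0 := by
  have hB : ∀ i, IsJoint (b.s i * (b.s i + 1)) (b.sz i - m' + m)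
      ((Sp N ^ m * Sm N ^ m') *ᵥ (b.vec i).ofLp) := fun i => by
    rw [← Matrix.mulVec_mulVec]; exact ((b.isJoint i).lower_pow m').raise_pow m
  rw [meso_operator_eq, gnsExp_smul, gnsExp_evol β ε Tc b _ _ _ t _ _
    (fun i => (b.isJoint i).bcsHmu_mulVec ε Tc μ) (fun i => (hB i).bcsHmu_mulVec ε Tc μ)]
  simp only [(b.isJoint _).dotProduct_ladder_of_ne hne, mul_zero, Finset.sum_const_zero]

/-- The scaled diagonal matrix elements of the ladder operators, as a function of
`x = s / N`, `y = s_z / N` and `h = 1 / N`. -/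
def ladderSymbol (n m' : ℕ) (x y h : ℝ) : ℝ :=
  (∏ k ∈ Finset.range n, (x * (x + h) - (y + k * h) ^ 2 - (y + k * h) * h)) *
    ∏ k ∈ Finset.range m', (x * (x + h) - (y - k * h) ^ 2 + (y - k * h) * h)

/-- The Bohr frequency for the transition `s_z → s_z + k`, in the same variables. -/
def bohrSymbol (ε Tc μ k y h : ℝ) : ℝ :=
  (-2 * ε + 2 * μ) * k + 2 * Tc * (2 * k * y + (k ^ 2 - k) * h)

theorem gnsExp_meso_of_eq (β ε Tc μ c t : ℝ) (hN : N ≠ 0) (b : SpinBasis N) {n n' m m' : ℕ}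
    (heq : (m : ℤ) - m' = (n : ℤ) - n') :
    gnsExp β ε Tc b (Em c N ^ n * Ep c N ^ n' * gnsEvol (bcsHmu ε Tc μ N) t * Ep c N ^ m *
      Em c N ^ m') =
    ∑ i, (weight β ε Tc b i : ℂ) *
      (Complex.exp (((-(t * bohrSymbol ε Tc μ (m - m') (b.sz i / N) (1 / N)) : ℝ) : ℂ) *
        Complex.I) * ((((c⁻¹) ^ (2 * (n + m')) *
          ladderSymbol n m' (b.s i / N) (b.sz i / N) (1 / N) : ℝ) : ℂ))) := by
  have hB : ∀ i, IsJoint (b.s i * (b.s i + 1)) (b.sz i - m' + m)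
      ((Sp N ^ m * Sm N ^ m') *ᵥ (b.vec i).ofLp) := fun i => by
    rw [← Matrix.mulVec_mulVec]; exact ((b.isJoint i).lower_pow m').raise_pow m
  rw [meso_operator_eq, gnsExp_smul, gnsExp_evol β ε Tc b _ _ _ t _ _
    (fun i => (b.isJoint i).bcsHmu_mulVec ε Tc μ) (fun i => (hB i).bcsHmu_mulVec ε Tc μ),
    Finset.mul_sum]
  refine Finset.sum_congr rfl fun i _ => ?_
  have hN' : (N : ℝ) ≠ 0 := by exact_mod_cast hN
  rw [(b.isJoint i).ladder_mulVec heq, dotProduct_smul, b.dotProduct_vec, if_pos rfl, smul_eq_mul,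
    mul_one, mul_left_comm]
  congr 1
  rw [mul_left_comm]
  congr 1
  · congr 4
    rw [bohrSymbol]
    field_simp
    ring
  · have e : n + n' + m + m' = 2 * (n + m') := by omega
    have e1 : ∀ k : ℕ, b.s i * (b.s i + 1) - (b.sz i + k) ^ 2 - (b.sz i + k) =
        (N : ℝ) ^ 2 * (b.s i / N * (b.s i / N + 1 / N) - (b.sz i / N + k * (1 / N)) ^ 2 -
          (b.sz i / N + k * (1 / N)) * (1 / N)) := fun k => by field_simp
    have e2 : ∀ k : ℕ, b.s i * (b.s i + 1) - (b.sz i - k) ^ 2 + (b.sz i - k) =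
        (N : ℝ) ^ 2 * (b.s i / N * (b.s i / N + 1 / N) - (b.sz i / N - k * (1 / N)) ^ 2 +
          (b.sz i / N - k * (1 / N)) * (1 / N)) := fun k => by field_simp
    rw [e, ladderSymbol]
    simp only [e1, e2, Finset.prod_mul_distrib, Finset.prod_const, Finset.card_range]
    rw [← Complex.ofReal_inv, ← Complex.ofReal_pow, ← Complex.ofReal_mul]
    congr 1
    have e3 : ((N : ℝ)⁻¹) ^ (2 * (n + m')) * (((N : ℝ) ^ 2) ^ n * ((N : ℝ) ^ 2) ^ m') = 1 := by
      rw [← pow_add, ← pow_mul, ← mul_pow, inv_mul_cancel₀ hN', one_pow]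
    have e4 : ∀ P Q : ℝ, ((c * N)⁻¹) ^ (2 * (n + m')) *
        ((((N : ℝ) ^ 2) ^ n * P) * (((N : ℝ) ^ 2) ^ m' * Q)) =
          c⁻¹ ^ (2 * (n + m')) * (P * Q) := by
      intro P Q
      rw [mul_inv, mul_pow]
      linear_combination (c⁻¹ ^ (2 * (n + m')) * P * Q) * e3
    exact e4 _ _

/-! ### Thermal expectations -/

theorem trace_eq_sum (b : SpinBasis N) (A : Op N) :
    A.trace = ∑ i, star (b.vec i).ofLp ⬝ᵥ (A *ᵥ (b.vec i).ofLp) := by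
  have h := LinearMap.trace_eq_sum_inner (Matrix.toEuclideanLin A) b.vec
  have h2 : LinearMap.trace ℂ _ (Matrix.toEuclideanLin A) = A.trace := by
    rw [Matrix.toEuclideanLin_eq_toLin_orthonormal]
    exact Matrix.trace_toLin_eq _ _
  rw [← h2, h]
  refine Finset.sum_congr rfl fun i _ => ?_
  rw [EuclideanSpace.inner_eq_star_dotProduct, dotProduct_comm]
  rfl

theorem trace_gibbs_mul (β ε Tc : ℝ) (b : SpinBasis N) :
    Matrix.trace (gibbs β ε Tc N * (Sp N * Sm N)) =
      ∑ i, (weight β ε Tc b i : ℂ) *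
        ((b.s i * (b.s i + 1) - b.sz i ^ 2 + b.sz i : ℝ) : ℂ) := by
  have hexp : ∀ i, NormedSpace.exp (-(β : ℂ) • bcsH ε Tc N) *ᵥ (b.vec i).ofLp =
      ((Real.exp (-β * eta ε Tc N (b.s i) (b.sz i)) : ℝ) : ℂ) • (b.vec i).ofLp := by
    intro i
    rw [Complex.ofReal_exp]
    apply exp_mulVec_of_eigen
    rw [Matrix.smul_mulVec, (b.isJoint i).bcsH_mulVec, smul_smul, eta]
    push_cast; rfl
  rw [gibbs, smul_mul_assoc, Matrix.trace_smul, trace_eq_sum b, trace_eq_sum b, smul_eq_mul,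
    Finset.mul_sum]
  refine Finset.sum_congr rfl fun i _ => ?_
  simp only [← Matrix.mulVec_mulVec _ (NormedSpace.exp _) _, (b.isJoint i).Sp_Sm,
    Matrix.mulVec_smul, hexp, dotProduct_smul, b.dotProduct_vec, if_pos, smul_eq_mul, weight]
  push_cast
  ring_nf

end

section

/-! ### Counting joint eigenvectors -/

variable {N : ℕ}

/-- The eigenvalue of `Sz` on a vector of the computational basis. -/
def confSz (x : Conf N) : ℝ := ∑ k, if x k = 0 then (1 / 2 : ℝ) else -(1 / 2)

theorem Sz_mulVec_apply (v : Conf N → ℂ) (x : Conf N) : (Sz N *ᵥ v) x = confSz x * v x := by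
  have h : ∀ k : Fin N, (siteOp k pauliZ *ᵥ v) x = (if x k = 0 then (1 : ℂ) else -1) * v x := by
    intro k
    rw [siteOp_mulVec, Fin.sum_univ_two]
    have hu : ∀ a, x k = a → Function.update x k a = x := by rintro a rfl; simp
    rcases Fin.exists_fin_two.1 ⟨x k, rfl⟩ with h0 | h0
    · rw [hu 0 h0, h0]; simp [pauliZ]
    · rw [hu 1 h0, h0]; simp [pauliZ]
  simp only [Sz, collective, Matrix.smul_mulVec, Matrix.sum_mulVec, Pi.smul_apply,
    Finset.sum_apply, h, ← Finset.sum_mul, confSz, smul_eq_mul, ← mul_assoc]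
  congr 1
  push_cast
  rw [Finset.mul_sum]
  refine Finset.sum_congr rfl fun k _ => ?_
  split_ifs <;> norm_num

theorem sum_exp_confSz (N : ℕ) (θ : ℝ) :
    ∑ x : Conf N, Real.exp (θ * confSz x) = (2 * Real.cosh (θ / 2)) ^ N := by
  have h := Finset.prod_univ_sum (fun _ : Fin N => (Finset.univ : Finset (Fin 2)))
    (fun _ a => Real.exp (θ * if a = 0 then (1 / 2 : ℝ) else -(1 / 2)))
  rw [Fintype.piFinset_univ] at h
  have e : ∑ a : Fin 2, Real.exp (θ * if a = 0 then (1 / 2 : ℝ) else -(1 / 2)) =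
      2 * Real.cosh (θ / 2) := by
    rw [Fin.sum_univ_two, Real.cosh_eq]
    simp only [if_true, one_ne_zero, if_false]
    ring_nf
  simp only [e, Finset.prod_const, Finset.card_univ, Fintype.card_fin] at h
  rw [h]
  refine Finset.sum_congr rfl fun x _ => ?_
  rw [← Real.exp_sum, confSz, Finset.mul_sum]

theorem confSz_eq (x : Conf N) :
    confSz x = ((Finset.univ.filter fun k => x k = 0).card : ℝ) - N / 2 := by
  have h : ∀ k, (if x k = 0 then (1 / 2 : ℝ) else -(1 / 2)) = (if x k = 0 then 1 else 0) - 1 / 2 := by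
    intro k; split_ifs <;> norm_num
  simp only [confSz, h, Finset.sum_sub_distrib, Finset.sum_boole, Finset.sum_const,
    Finset.card_univ, Fintype.card_fin, nsmul_eq_mul]
  ring

/-- The set of values of `Sz`. -/
def szValues (N : ℕ) : Finset ℝ := Finset.univ.image (confSz (N := N))

theorem card_szValues_le (N : ℕ) : (szValues N).card ≤ N + 1 := by
  have : szValues N ⊆ (Finset.range (N + 1)).image fun k : ℕ => (k : ℝ) - N / 2 := by
    intro s hs
    obtain ⟨x, -, rfl⟩ := Finset.mem_image.1 hs
    refine Finset.mem_image.2 ⟨_, ?_, (confSz_eq x).symm⟩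
    rw [Finset.mem_range, Nat.lt_succ_iff]
    exact (Finset.card_le_univ _).trans (by simp)
  exact (Finset.card_le_card this).trans (Finset.card_image_le.trans (by simp))

theorem abs_le_of_mem_szValues {s : ℝ} (hs : s ∈ szValues N) : |s| ≤ N / 2 := by
  obtain ⟨x, -, rfl⟩ := Finset.mem_image.1 hs
  have h : ((Finset.univ.filter fun k => x k = 0).card : ℝ) ≤ N := by
    exact_mod_cast (Finset.card_le_univ _).trans (by simp)
  rw [confSz_eq, abs_le]
  constructor <;> linarith [Nat.cast_nonneg (α := ℝ) (Finset.univ.filter fun k => x k = 0).card]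

/-- The number of vectors of the computational basis with `Sz` eigenvalue `s`. -/
def szCount (N : ℕ) (s : ℝ) : ℕ := (Finset.univ.filter fun x : Conf N => confSz x = s).card

theorem mem_szValues_of_szCount_pos {s : ℝ} (h : 0 < szCount N s) : s ∈ szValues N := by
  obtain ⟨x, hx⟩ := Finset.card_pos.1 h
  exact Finset.mem_image.2 ⟨x, Finset.mem_univ _, (Finset.mem_filter.1 hx).2⟩

theorem sum_szCount (N : ℕ) (f : ℝ → ℝ) :
    ∑ s ∈ szValues N, szCount N s * f s = ∑ x : Conf N, f (confSz x) := by
  rw [← Finset.sum_fiberwise_of_maps_to (s := Finset.univ) (t := szValues N) (g := confSz)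
    (fun x hx => Finset.mem_image_of_mem _ hx)]
  refine Finset.sum_congr rfl fun s _ => ?_
  rw [Finset.sum_congr rfl (g := fun _ => f s) fun x hx => by rw [(Finset.mem_filter.1 hx).2],
    Finset.sum_const, nsmul_eq_mul, szCount]

theorem card_le_card_of_orthogonal {κ : Type*} (b : OrthonormalBasis (Conf N) ℂ
    (EuclideanSpace ℂ (Conf N))) (S : Finset κ) (D : Finset (Conf N)) (u : κ → Conf N → ℂ)
    (h0 : ∀ a ∈ S, star (u a) ⬝ᵥ u a ≠ 0)
    (hu : ∀ a ∈ S, ∀ a' ∈ S, a ≠ a' → star (u a) ⬝ᵥ u a' = 0)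
    (hD : ∀ a ∈ S, ∀ i ∉ D, star (b i).ofLp ⬝ᵥ u a = 0) : S.card ≤ D.card := by
  classical
  have hin : ∀ v w : EuclideanSpace ℂ (Conf N), inner ℂ v w = star v.ofLp ⬝ᵥ w.ofLp := by
    intro v w
    rw [EuclideanSpace.inner_eq_star_dotProduct, dotProduct_comm]
  let w : S → EuclideanSpace ℂ (Conf N) := fun a => WithLp.toLp 2 (u a)
  have hli : LinearIndependent ℂ w := by
    refine linearIndependent_of_ne_zero_of_inner_eq_zero (𝕜 := ℂ) ?_ ?_
    · intro a ha
      refine h0 a a.2 ?_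
      have := hin (w a) (w a)
      rw [ha, inner_zero_left] at this
      rw [show u a = (w a).ofLp from rfl, ha]
      simp
    · intro a a' haa'
      change inner ℂ (w a) (w a') = 0
      rw [hin]
      exact hu a a.2 a' a'.2 fun h => haa' (Subtype.ext h)
  have hsp : Set.range w ⊆ (↑(Submodule.span ℂ
      ((D.image b : Finset (EuclideanSpace ℂ (Conf N))) : Set (EuclideanSpace ℂ (Conf N)))) :
      Set (EuclideanSpace ℂ (Conf N))) := by
    rintro _ ⟨a, rfl⟩
    rw [SetLike.mem_coe, ← b.sum_repr (w a)]
    refine Submodule.sum_mem _ fun i _ => ?_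
    by_cases hi : i ∈ D
    · exact Submodule.smul_mem _ _ (Submodule.subset_span (by simpa using ⟨i, hi, rfl⟩))
    · rw [b.repr_apply_apply, hin, hD a a.2 i hi, zero_smul]
      exact Submodule.zero_mem _
  have h1 := Submodule.finrank_mono (Submodule.span_le.2 hsp)
  rw [finrank_span_eq_card hli, Fintype.card_coe] at h1
  exact h1.trans ((finrank_span_finset_le_card _).trans Finset.card_image_le)

namespace IsJoint

variable {s z : ℝ} {v : Conf N → ℂ}

theorem abs_le (h : IsJoint (s * (s + 1)) z v) (hs : 0 ≤ s) (hv : v ≠ 0) : |z| ≤ s := by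
  have hpos : 0 < (star v ⬝ᵥ v).re := by
    open scoped ComplexOrder in
    exact (Complex.lt_def.1 (Matrix.dotProduct_star_self_pos_iff.2 hv : 0 < star v ⬝ᵥ v)).1
  have key : ∀ r : ℝ, ∀ A : Op N, (Aᴴ * A) *ᵥ v = (r : ℂ) • v → 0 ≤ r := by
    intro r A hA
    have h1 : 0 ≤ (star v ⬝ᵥ ((Aᴴ * A) *ᵥ v)).re := by
      open scoped ComplexOrder in
      exact (Complex.le_def.1
        ((Matrix.posSemidef_conjTranspose_mul_self A).dotProduct_mulVec_nonneg v)).1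
    rw [hA, dotProduct_smul, smul_eq_mul, Complex.re_ofReal_mul] at h1
    exact nonneg_of_mul_nonneg_left h1 hpos
  have h1 := key _ (Sp N) (by rw [Sp_conjTranspose]; exact h.Sm_Sp)
  have h2 := key _ (Sm N) (by rw [Sm_conjTranspose]; exact h.Sp_Sm)
  rw [_root_.abs_le]
  constructor <;> by_contra! hc <;> nlinarith

theorem exists_raise_eq (h : IsJoint (s * (s + 1)) z v) (hs : 0 ≤ s) (hv : v ≠ 0) :
    ∃ l : ℕ, z + l = s := by
  by_contra! hne
  obtain ⟨hz1, hz2⟩ := _root_.abs_le.1 (h.abs_le hs hv)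
  have hle : ∀ l : ℕ, z + l ≤ s := by
    intro l
    refine (le_abs_self _).trans ((h.raise_pow l).abs_le hs fun h0 => ?_)
    have e := h.Sm_pow_Sp_pow l
    rw [← Matrix.mulVec_mulVec, h0, Matrix.mulVec_zero] at e
    refine (smul_ne_zero (Complex.ofReal_ne_zero.2 (Finset.prod_ne_zero_iff.2 ?_)) hv) e.symm
    intro k _
    have h1 : s - (z + k) ≠ 0 := sub_ne_zero.2 (hne k).symm
    have h2 : s + (z + k) + 1 ≠ 0 := by
      have := Nat.cast_nonneg (α := ℝ) k
      linarith
    have e2 : s * (s + 1) - (z + k) ^ 2 - (z + k) = (s - (z + k)) * (s + (z + k) + 1) := by ring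
    rw [e2]
    exact mul_ne_zero h1 h2
  obtain ⟨l, hl⟩ := exists_nat_gt (s - z)
  linarith [hle l]

theorem apply_eq_zero {c : ℝ} (h : IsJoint c z v) {x : Conf N} (hx : confSz x ≠ z) : v x = 0 := by
  have e := congrFun h.sz_eq x
  rw [Sz_mulVec_apply, Pi.smul_apply, smul_eq_mul] at e
  have e' : ((confSz x : ℂ) - z) * v x = 0 := by rw [sub_mul, e, sub_self]
  refine (mul_eq_zero.1 e').resolve_left fun h0 => hx ?_
  exact_mod_cast sub_eq_zero.1 h0

end IsJoint

namespace SpinBasis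

variable (b : SpinBasis N)

theorem vec_ne_zero (i : Conf N) : (b.vec i).ofLp ≠ 0 := by
  intro h
  have := b.dotProduct_vec i i
  rw [h] at this
  simp at this

theorem abs_sz_le (i : Conf N) : |b.sz i| ≤ b.s i :=
  (b.isJoint i).abs_le (b.s_nonneg i) (b.vec_ne_zero i)

theorem sz_mem (i : Conf N) : b.sz i ∈ szValues N := by
  obtain ⟨x, hx⟩ := Function.ne_iff.1 (b.vec_ne_zero i)
  refine Finset.mem_image.2 ⟨x, Finset.mem_univ _, ?_⟩
  by_contra h
  exact hx ((b.isJoint i).apply_eq_zero h)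

theorem card_eigen_le (s z : ℝ) :
    (Finset.univ.filter fun i => b.s i = s ∧ b.sz i = z).card ≤ szCount N s := by
  rcases (Finset.univ.filter fun i => b.s i = s ∧ b.sz i = z).eq_empty_or_nonempty with h | ⟨i₀, h⟩
  · rw [h]; simp
  have hJ : ∀ i ∈ Finset.univ.filter fun i => b.s i = s ∧ b.sz i = z,
      IsJoint (s * (s + 1)) z (b.vec i).ofLp := by
    intro i hi
    obtain ⟨-, h1, h2⟩ := Finset.mem_filter.1 hi
    rw [← h1, ← h2]
    exact b.isJoint i
  have hs : 0 ≤ s := (Finset.mem_filter.1 h).2.1 ▸ b.s_nonneg i₀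
  obtain ⟨l, hl⟩ := (hJ i₀ h).exists_raise_eq hs (b.vec_ne_zero i₀)
  have hz := (_root_.abs_le.1 ((hJ i₀ h).abs_le hs (b.vec_ne_zero i₀))).1
  have hQ : (∏ k ∈ Finset.range l, (s * (s + 1) - (z + k) ^ 2 - (z + k))) ≠ 0 := by
    refine Finset.prod_ne_zero_iff.2 fun k hk => ?_
    have h1 : (k : ℝ) < l := by exact_mod_cast Finset.mem_range.1 hk
    have h2 : (0 : ℝ) ≤ k := Nat.cast_nonneg k
    have e2 : s * (s + 1) - (z + k) ^ 2 - (z + k) = (s - (z + k)) * (s + (z + k) + 1) := by ring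
    rw [e2]
    exact mul_ne_zero (by linarith) (by linarith)
  have hip : ∀ i, ∀ j ∈ Finset.univ.filter fun i => b.s i = s ∧ b.sz i = z,
      star (Sp N ^ l *ᵥ (b.vec i).ofLp) ⬝ᵥ (Sp N ^ l *ᵥ (b.vec j).ofLp) =
      ((∏ k ∈ Finset.range l, (s * (s + 1) - (z + k) ^ 2 - (z + k)) : ℝ) : ℂ) *
        (if i = j then 1 else 0) := by
    intro i j hj
    rw [star_mulVec_dotProduct, Matrix.conjTranspose_pow, Sp_conjTranspose, Matrix.mulVec_mulVec,
      (hJ j hj).Sm_pow_Sp_pow, dotProduct_smul, b.dotProduct_vec, smul_eq_mul]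
  refine card_le_card_of_orthogonal (EuclideanSpace.basisFun (Conf N) ℂ) _ _
    (fun i => Sp N ^ l *ᵥ (b.vec i).ofLp) ?_ ?_ ?_
  · intro i hi
    rw [hip i i hi, if_pos rfl, mul_one]
    exact Complex.ofReal_ne_zero.2 hQ
  · intro i _ j hj hij
    rw [hip i j hj, if_neg hij, mul_zero]
  · intro i hi x hx
    have hx' : confSz x ≠ z + l := by
      rw [hl]; simpa using hx
    have := ((hJ i hi).raise_pow l).apply_eq_zero hx'
    simpa [dotProduct, Pi.single_apply] using this

theorem s_mem (i : Conf N) : b.s i ∈ szValues N :=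
  mem_szValues_of_szCount_pos <| (Finset.card_pos.2 ⟨i, by simp⟩).trans_le
    (b.card_eigen_le (b.s i) (b.sz i))

theorem szCount_le_card_sz (s : ℝ) :
    szCount N s ≤ (Finset.univ.filter fun i => b.sz i = s).card := by
  refine card_le_card_of_orthogonal b.vec _ _ (fun x => Pi.single x 1) ?_ ?_ ?_
  · intro x _
    simp [dotProduct, Pi.single_apply]
  · intro x _ y _ hxy
    simp [dotProduct, Pi.single_apply, hxy.symm]
  · intro x hx i hi
    have h1 : confSz x ≠ b.sz i := by
      rw [(Finset.mem_filter.1 hx).2]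
      simpa [eq_comm] using hi
    simp [(b.isJoint i).apply_eq_zero h1]

theorem szCount_le_card (m : ℝ) (l : ℕ) (h : |m| ≤ m + l) :
    szCount N (m + l) ≤ (Finset.univ.filter fun i => b.sz i = m ∧ m + l ≤ b.s i).card := by
  refine (b.szCount_le_card_sz _).trans ?_
  have hip : ∀ i, ∀ j ∈ Finset.univ.filter fun i => b.sz i = m + l,
      star (Sm N ^ l *ᵥ (b.vec i).ofLp) ⬝ᵥ (Sm N ^ l *ᵥ (b.vec j).ofLp) =
      ((∏ k ∈ Finset.range l, (b.s j * (b.s j + 1) - (b.sz j - k) ^ 2 + (b.sz j - k)) : ℝ) : ℂ) *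
        (if i = j then 1 else 0) := by
    intro i j hj
    rw [star_mulVec_dotProduct, Matrix.conjTranspose_pow, Sm_conjTranspose, Matrix.mulVec_mulVec,
      (b.isJoint j).Sp_pow_Sm_pow, dotProduct_smul, b.dotProduct_vec, smul_eq_mul]
  have hm := _root_.abs_le.1 h
  refine card_le_card_of_orthogonal b.vec _ _ (fun i => Sm N ^ l *ᵥ (b.vec i).ofLp) ?_ ?_ ?_
  · intro i hi
    rw [hip i i hi, if_pos rfl, mul_one]
    refine Complex.ofReal_ne_zero.2 (Finset.prod_ne_zero_iff.2 fun k hk => ?_)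
    have h1 : (k : ℝ) + 1 ≤ l := by exact_mod_cast Finset.mem_range.1 hk
    have h2 : (0 : ℝ) ≤ k := Nat.cast_nonneg k
    have h3 := (_root_.abs_le.1 (b.abs_sz_le i)).2
    rw [(Finset.mem_filter.1 hi).2] at h3 ⊢
    have e2 : b.s i * (b.s i + 1) - (m + l - k) ^ 2 + (m + l - k) =
      (b.s i + (m + l - k)) * (b.s i - (m + l - k) + 1) := by ring
    rw [e2]
    exact (mul_pos (by linarith) (by linarith)).ne'
  · intro i _ j hj hij
    rw [hip i j hj, if_neg hij, mul_zero]
  · intro i hi j hj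
    have h3 := (_root_.abs_le.1 (b.abs_sz_le i)).2
    have hJ := (b.isJoint i).lower_pow l
    rw [(Finset.mem_filter.1 hi).2] at h3 hJ
    by_cases hz : b.sz j = m
    · refine (b.isJoint j).dotProduct_eq_zero_of_casimir hJ fun hc => hj ?_
      refine Finset.mem_filter.2 ⟨Finset.mem_univ _, hz, h3.trans ?_⟩
      by_contra! hlt
      have h4 := b.s_nonneg j
      nlinarith
    · exact (b.isJoint j).dotProduct_eq_zero_of_sz hJ (by simpa using hz)

end SpinBasis

end

/-! ### The Curie–Weiss free energy -/

theorem strictConvexOn_sinh : StrictConvexOn ℝ (Set.Ici 0) Real.sinh := by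
  refine strictConvexOn_of_deriv2_pos (convex_Ici 0) Real.continuous_sinh.continuousOn fun x hx => ?_
  rw [interior_Ici] at hx
  simpa using hx

theorem tanh_mul_lt_tanh_mul {u v : ℝ} (hu : 0 < u) (huv : u < v) :
    Real.tanh v * u < Real.tanh u * v := by
  have h1 := strictConvexOn_sinh.secant_strict_mono (a := 0) (x := v - u) (y := v + u) (by simp)
    (by simpa using huv.le) (by simp; linarith) (by linarith) (by linarith) (by linarith)
  have hcu := Real.cosh_pos u
  have hcv := Real.cosh_pos v
  rw [Real.sinh_zero, sub_zero, sub_zero, sub_zero, sub_zero,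
    div_lt_div_iff₀ (by linarith) (by linarith), Real.sinh_sub, Real.sinh_add] at h1
  rw [Real.tanh_eq_sinh_div_cosh, Real.tanh_eq_sinh_div_cosh, div_mul_eq_mul_div,
    div_mul_eq_mul_div, div_lt_div_iff₀ hcv hcu]
  nlinarith

/-- The Curie–Weiss free energy functional `log (2 cosh (a x)) - a x²`. -/
def cwFree (a x : ℝ) : ℝ := Real.log (2 * Real.cosh (a * x)) - a * x ^ 2

theorem hasDerivAt_cwFree (a x : ℝ) :
    HasDerivAt (cwFree a) (a * (Real.tanh (a * x) - 2 * x)) x := by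
  have h1 : HasDerivAt (fun x => 2 * Real.cosh (a * x)) (2 * (Real.sinh (a * x) * (a * 1))) x :=
    (((hasDerivAt_id x).const_mul a).cosh).const_mul 2
  have h2 := (h1.log (by have := Real.cosh_pos (a * x); positivity)).sub
    (((hasDerivAt_id x).pow 2).const_mul a)
  refine h2.congr_deriv ?_
  have := (Real.cosh_pos (a * x)).ne'
  rw [Real.tanh_eq_sinh_div_cosh]
  simp
  field_simp

theorem continuous_cwFree (a : ℝ) : Continuous (cwFree a) :=
  continuous_iff_continuousAt.2 fun x => (hasDerivAt_cwFree a x).continuousAt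

theorem cwFree_abs (a x : ℝ) : cwFree a |x| = cwFree a x := by
  rcases abs_cases x with ⟨h, -⟩ | ⟨h, -⟩ <;> simp [h, cwFree]

section

variable {a x₀ : ℝ}

theorem cwFree_strictMonoOn (ha : 0 < a) (hx₀ : 0 < x₀) (h : Real.tanh (a * x₀) = 2 * x₀) :
    StrictMonoOn (cwFree a) (Set.Icc 0 x₀) := by
  refine strictMonoOn_of_deriv_pos (convex_Icc 0 x₀) (continuous_cwFree a).continuousOn
    fun x hx => ?_
  rw [interior_Icc] at hx
  rw [(hasDerivAt_cwFree a x).deriv]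
  have := tanh_mul_lt_tanh_mul (mul_pos ha hx.1) (mul_lt_mul_of_pos_left hx.2 ha)
  rw [h] at this
  refine mul_pos ha (sub_pos.2 ?_)
  have h3 : (2 * x) * (a * x₀) < Real.tanh (a * x) * (a * x₀) := by linarith
  exact lt_of_mul_lt_mul_right h3 (mul_pos ha hx₀).le

theorem cwFree_strictAntiOn (ha : 0 < a) (hx₀ : 0 < x₀) (h : Real.tanh (a * x₀) = 2 * x₀) :
    StrictAntiOn (cwFree a) (Set.Ici x₀) := by
  refine strictAntiOn_of_deriv_neg (convex_Ici x₀) (continuous_cwFree a).continuousOn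
    fun x hx => ?_
  rw [interior_Ici] at hx
  rw [(hasDerivAt_cwFree a x).deriv]
  have := tanh_mul_lt_tanh_mul (mul_pos ha hx₀) (mul_lt_mul_of_pos_left hx ha)
  rw [h] at this
  refine mul_neg_of_pos_of_neg ha (sub_neg.2 ?_)
  have h3 : Real.tanh (a * x) * (a * x₀) < (2 * x) * (a * x₀) := by linarith
  exact lt_of_mul_lt_mul_right h3 (mul_pos ha hx₀).le

theorem cwFree_le (ha : 0 < a) (hx₀ : 0 < x₀) (h : Real.tanh (a * x₀) = 2 * x₀) (x : ℝ) :
    cwFree a x ≤ cwFree a x₀ := by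
  rw [← cwFree_abs a x]
  rcases le_total |x| x₀ with hx | hx
  · exact (cwFree_strictMonoOn ha hx₀ h).monotoneOn ⟨abs_nonneg x, hx⟩ ⟨hx₀.le, le_rfl⟩ hx
  · exact (cwFree_strictAntiOn ha hx₀ h).antitoneOn (Set.mem_Ici.2 le_rfl) hx hx

theorem exists_cwFree_gap (ha : 0 < a) (hx₀ : 0 < x₀) (h : Real.tanh (a * x₀) = 2 * x₀) {δ : ℝ}
    (hδ : 0 < δ) :
    ∃ c > 0, ∀ x, 0 ≤ x → δ ≤ |x - x₀| → cwFree a x ≤ cwFree a x₀ - c := by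
  set r := max 0 (x₀ - δ) with hr
  have hr0 : 0 ≤ r := le_max_left _ _
  have hrx : r < x₀ := max_lt hx₀ (by linarith)
  have h1 := cwFree_strictMonoOn ha hx₀ h ⟨hr0, hrx.le⟩ ⟨hx₀.le, le_rfl⟩ hrx
  have h2 : cwFree a (x₀ + δ) < cwFree a x₀ := cwFree_strictAntiOn ha hx₀ h
    (Set.mem_Ici.2 le_rfl) (Set.mem_Ici.2 (by linarith)) (by linarith)
  refine ⟨min (cwFree a x₀ - cwFree a r) (cwFree a x₀ - cwFree a (x₀ + δ)),
    lt_min (sub_pos.2 h1) (sub_pos.2 h2), fun x hx hxδ => ?_⟩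
  rcases le_abs'.1 hxδ with hc | hc
  · have hxr : x ≤ r := le_trans (by linarith) (le_max_right 0 (x₀ - δ))
    have := (cwFree_strictMonoOn ha hx₀ h).monotoneOn ⟨hx, hxr.trans hrx.le⟩ ⟨hr0, hrx.le⟩ hxr
    linarith [min_le_left (cwFree a x₀ - cwFree a r) (cwFree a x₀ - cwFree a (x₀ + δ))]
  · have hxr : x₀ + δ ≤ x := by linarith
    have := (cwFree_strictAntiOn ha hx₀ h).antitoneOn (Set.mem_Ici.2 (by linarith))
      (Set.mem_Ici.2 (by linarith)) hxr
    linarith [min_le_right (cwFree a x₀ - cwFree a r) (cwFree a x₀ - cwFree a (x₀ + δ))]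

end

theorem two_cosh_pow_eq (a x : ℝ) (N : ℕ) :
    (2 * Real.cosh (a * x)) ^ N = Real.exp (N * (cwFree a x + a * x ^ 2)) := by
  have := Real.cosh_pos (a * x)
  rw [cwFree, sub_add_cancel, Real.exp_nat_mul, Real.exp_log (by positivity)]

theorem szCount_le_exp {N : ℕ} (a s : ℝ) :
    (szCount N s : ℝ) ≤ Real.exp (N * cwFree a (s / N) - a * s ^ 2 / N) := by
  rcases Nat.eq_zero_or_pos (szCount N s) with h0 | hpos
  · rw [h0, Nat.cast_zero]; exact (Real.exp_pos _).le
  have h := sum_szCount N fun r => Real.exp (2 * a * (s / N) * r)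
  simp only [sum_exp_confSz] at h
  have h1 := Finset.single_le_sum (f := fun r => (szCount N r : ℝ) * Real.exp (2 * a * (s / N) * r))
    (fun r _ => by positivity) (mem_szValues_of_szCount_pos hpos)
  rw [h, show 2 * a * (s / N) / 2 = a * (s / N) by ring, two_cosh_pow_eq, ← le_div_iff₀
    (Real.exp_pos _), ← Real.exp_sub] at h1
  refine h1.trans_eq ?_
  congr 1
  rcases eq_or_ne (N : ℝ) 0 with hN | hN
  · simp [hN]
  · field_simp; ring

/-! ### Concentration of the Boltzmann weights -/

theorem tendsto_add_one_pow_mul_exp (k : ℕ) {c : ℝ} (hc : 0 < c) :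
    Tendsto (fun N : ℕ => ((N : ℝ) + 1) ^ k * Real.exp (-c * N)) atTop (𝓝 0) := by
  have h1 : Tendsto (fun N : ℕ => c * ((N : ℝ) + 1)) atTop atTop :=
    (tendsto_atTop_add_const_right _ 1 tendsto_natCast_atTop_atTop).const_mul_atTop hc
  have h2 := ((Real.tendsto_pow_mul_exp_neg_atTop_nhds_zero k).comp h1).const_mul
    (Real.exp c / c ^ k)
  rw [mul_zero] at h2
  refine h2.congr fun N => ?_
  have e : Real.exp (-c * N) = Real.exp c * Real.exp (-(c * ((N : ℝ) + 1))) := by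
    rw [← Real.exp_add]; congr 1; ring
  rw [Function.comp_apply, e, mul_pow]
  field_simp

/-- `(x, y)` is the location of the interior maximum of the free energy in the variables
`(s / N, s_z / N)`. -/
structure IsSaddle (β ε Tc x y : ℝ) : Prop where
  β_pos : 0 < β
  Tc_pos : 0 < Tc
  tanh_eq : Real.tanh (2 * β * Tc * x) = 2 * x
  eps_eq : ε = 2 * Tc * y
  abs_lt : |y| < x

namespace IsSaddle

variable {β ε Tc x₀ y₀ : ℝ} {N : ℕ}

theorem coupling_pos (h : IsSaddle β ε Tc x₀ y₀) : 0 < 2 * β * Tc :=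
  mul_pos (mul_pos two_pos h.β_pos) h.Tc_pos

theorem pos (h : IsSaddle β ε Tc x₀ y₀) : 0 < x₀ := (abs_nonneg _).trans_lt h.abs_lt

theorem neg_mul_eta (h : IsSaddle β ε Tc x₀ y₀) (hN : N ≠ 0) (s m : ℝ) :
    -β * eta ε Tc N s m = 2 * β * Tc * (N * y₀ ^ 2 - (m - N * y₀) ^ 2 / N +
      s ^ 2 / N + (s + m) / N) := by
  have : (N : ℝ) ≠ 0 := by exact_mod_cast hN
  rw [eta, h.eps_eq]
  field_simp
  ring

theorem szCount_mul_exp_le (h : IsSaddle β ε Tc x₀ y₀) (hN : N ≠ 0) {s m : ℝ}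
    (hs : |s| ≤ N / 2) (hm : |m| ≤ N / 2) :
    szCount N s * Real.exp (-β * eta ε Tc N s m) ≤
      Real.exp (2 * β * Tc) * Real.exp (N * (cwFree (2 * β * Tc) (s / N) +
        2 * β * Tc * (y₀ ^ 2 - (m / N - y₀) ^ 2))) := by
  have ha := h.coupling_pos
  have hN' : (0 : ℝ) < N := by exact_mod_cast Nat.pos_of_ne_zero hN
  refine (mul_le_mul_of_nonneg_right (szCount_le_exp (2 * β * Tc) s) (Real.exp_pos _).le).trans ?_
  rw [← Real.exp_add, ← Real.exp_add, Real.exp_le_exp, h.neg_mul_eta hN]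
  have h1 : (s + m) / N ≤ 1 := by
    rw [div_le_one hN']; linarith [le_abs_self s, le_abs_self m]
  have h2 : (m - N * y₀) ^ 2 / N = N * (m / N - y₀) ^ 2 := by field_simp
  have h3 := mul_le_mul_of_nonneg_left h1 ha.le
  rw [h2]
  have h4 : 2 * β * Tc * s ^ 2 / N = 2 * β * Tc * (s ^ 2 / N) := by ring
  rw [h4]
  linarith

theorem szCount_mul_exp_le_partition (h : IsSaddle β ε Tc x₀ y₀) (hN : N ≠ 0) (b : SpinBasis N)
    (m : ℝ) (l : ℕ) (hm : |m| ≤ m + l) :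
    szCount N (m + l) * Real.exp (-β * eta ε Tc N (m + l) m) ≤
      ∑ i, Real.exp (-β * eta ε Tc N (b.s i) (b.sz i)) := by
  have hN' : (0 : ℝ) < N := by exact_mod_cast Nat.pos_of_ne_zero hN
  have h1 : (szCount N (m + l) : ℝ) ≤
      ((Finset.univ.filter fun i => b.sz i = m ∧ m + l ≤ b.s i).card : ℝ) := by
    exact_mod_cast b.szCount_le_card m l hm
  refine (mul_le_mul_of_nonneg_right h1 (Real.exp_pos _).le).trans ?_
  rw [← nsmul_eq_mul, ← Finset.sum_const]
  refine (Finset.sum_le_sum fun i hi => ?_).trans (Finset.sum_le_sum_of_subset_of_nonneg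
    (Finset.subset_univ _) fun _ _ _ => (Real.exp_pos _).le)
  obtain ⟨-, hz, hs⟩ := Finset.mem_filter.1 hi
  have h0 : 0 ≤ m + l := (abs_nonneg m).trans hm
  rw [Real.exp_le_exp, h.neg_mul_eta hN, h.neg_mul_eta hN, hz]
  refine mul_le_mul_of_nonneg_left ?_ h.coupling_pos.le
  gcongr

/-- The `Sz` eigenvalue closest from below to the saddle point. -/
theorem exists_lattice_point (N : ℕ) (y : ℝ) :
    ∃ m : ℝ, |m - N * y| ≤ 1 ∧ ∀ s ∈ szValues N, |m| ≤ s → ∃ l : ℕ, s = m + l := by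
  refine ⟨⌊N * y + N / 2⌋ - N / 2, ?_, fun s hs hms => ?_⟩
  · have h1 := Int.floor_le (N * y + N / 2 : ℝ)
    have h2 := Int.lt_floor_add_one (N * y + N / 2 : ℝ)
    rw [abs_le]; constructor <;> linarith
  · obtain ⟨x, -, rfl⟩ := Finset.mem_image.1 hs
    have h1 := (le_abs_self _).trans hms
    rw [confSz_eq] at h1 ⊢
    set k := (Finset.univ.filter fun k => x k = 0).card
    have h2 : ⌊(N * y + N / 2 : ℝ)⌋ ≤ (k : ℤ) := by
      have : ((⌊(N * y + N / 2 : ℝ)⌋ : ℤ) : ℝ) ≤ ((k : ℤ) : ℝ) := by push_cast; linarith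
      exact_mod_cast this
    obtain ⟨l, hl⟩ := Int.eq_ofNat_of_zero_le (sub_nonneg.2 h2)
    refine ⟨l, ?_⟩
    have hl' : ((k : ℤ) : ℝ) - ⌊(N * y + N / 2 : ℝ)⌋ = l := by exact_mod_cast hl
    push_cast at hl'
    linarith

theorem partition_lower_bound (h : IsSaddle β ε Tc x₀ y₀) :
    ∀ᶠ N : ℕ in atTop, ∀ b : SpinBasis N,
      Real.exp (N * (cwFree (2 * β * Tc) x₀ + 2 * β * Tc * y₀ ^ 2)) ≤
        2 * (N + 1) * Real.exp (2 * β * Tc) *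
          ∑ i, Real.exp (-β * eta ε Tc N (b.s i) (b.sz i)) := by
  set a := 2 * β * Tc with ha_def
  have ha : 0 < a := h.coupling_pos
  set d := x₀ - |y₀| with hd_def
  have hd : 0 < d := sub_pos.2 h.abs_lt
  have hlim : Tendsto (fun N : ℕ => ((N : ℝ) + 1) * Real.exp (-(a * d ^ 2 / 4) * N)) atTop
      (𝓝 0) := by
    simpa using tendsto_add_one_pow_mul_exp 1 (c := a * d ^ 2 / 4) (by positivity)
  filter_upwards [eventually_gt_atTop 0, hlim.eventually_le_const (u := 1 / 2) (by norm_num),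
    tendsto_natCast_atTop_atTop.eventually_ge_atTop (2 / d)] with N hN0 hNexp hNd b
  have hN : N ≠ 0 := hN0.ne'
  have hN' : (0 : ℝ) < N := by exact_mod_cast hN0
  obtain ⟨m, hm1, hm2⟩ := exists_lattice_point N y₀
  set Z := ∑ i, Real.exp (-β * eta ε Tc N (b.s i) (b.sz i)) with hZ
  have hZpos : 0 < Z := partition_pos β ε Tc b
  set W := Real.exp (N * (cwFree a x₀ + a * x₀ ^ 2)) with hW
  set K := Real.exp (N * (a * y₀ ^ 2) - a - N * (a * x₀ ^ 2)) with hK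
  set f : ℝ → ℝ := fun s => szCount N s * Real.exp (2 * a * x₀ * s) with hf
  have htot : ∑ s ∈ szValues N, f s = W := by
    rw [sum_szCount N fun s => Real.exp (2 * a * x₀ * s), sum_exp_confSz, hW, ← two_cosh_pow_eq]
    congr 3; ring
  have hbig : ∀ s ∈ szValues N, |m| ≤ s → f s * K ≤ Z := by
    intro s hs hms
    obtain ⟨l, rfl⟩ := hm2 s hs hms
    refine le_trans ?_ (h.szCount_mul_exp_le_partition hN b m l hms)
    rw [hf, mul_assoc, hK, ← Real.exp_add]
    refine mul_le_mul_of_nonneg_left (Real.exp_le_exp.2 ?_) (Nat.cast_nonneg _)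
    rw [h.neg_mul_eta hN, ← ha_def]
    have e1 : (m - N * y₀) ^ 2 / N ≤ 1 := by
      rw [div_le_one hN']
      have : (m - N * y₀) ^ 2 ≤ 1 := by rw [sq_le_one_iff_abs_le_one]; exact hm1
      have h1N : (1 : ℝ) ≤ N := by exact_mod_cast hN0
      linarith
    have e2 : 0 ≤ (m + l + m) / N := div_nonneg (by linarith [neg_abs_le m]) hN'.le
    have e3 : 2 * x₀ * (m + l) - N * x₀ ^ 2 ≤ (m + l) ^ 2 / N := by
      rw [le_div_iff₀ hN']
      nlinarith [sq_nonneg (m + l - N * x₀)]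
    nlinarith
  have hsmall : ∀ s ∈ szValues N, ¬ |m| ≤ s → f s ≤ W * Real.exp (-(a * d ^ 2 / 4) * N) := by
    intro s hs hms
    refine (mul_le_mul_of_nonneg_right (szCount_le_exp a s) (Real.exp_pos _).le).trans ?_
    rw [hW, ← Real.exp_add, ← Real.exp_add, Real.exp_le_exp]
    have e1 := mul_le_mul_of_nonneg_left (cwFree_le ha h.pos h.tanh_eq (s / N)) hN'.le
    have e2 : N * d / 2 ≤ N * x₀ - s := by
      have h1 : |m| ≤ 1 + N * |y₀| := by
        have := abs_sub_abs_le_abs_sub m (N * y₀)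
        rw [abs_mul, Nat.abs_cast] at this
        linarith
      have h2 : 2 ≤ N * d := by rwa [div_le_iff₀ hd] at hNd
      have h3 : N * d = N * x₀ - N * |y₀| := by rw [hd_def]; ring
      linarith
    have e3 : (N * d / 2) ^ 2 ≤ (N * x₀ - s) ^ 2 := pow_le_pow_left₀ (by positivity) e2 2
    have e4 : -(a * s ^ 2 / N) + 2 * a * x₀ * s = N * (a * x₀ ^ 2) - a * ((N * x₀ - s) ^ 2 / N) := by
      field_simp; ring
    have e5 : N * (d ^ 2 / 4) ≤ (N * x₀ - s) ^ 2 / N := by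
      rw [le_div_iff₀ hN']; linarith
    nlinarith
  have hcard : ((szValues N).card : ℝ) ≤ N + 1 := by exact_mod_cast card_szValues_le N
  have hWpos : 0 < W := Real.exp_pos _
  have hKpos : 0 < K := Real.exp_pos _
  have hall : ∀ s ∈ szValues N, f s ≤ Z / K + W * Real.exp (-(a * d ^ 2 / 4) * N) := by
    intro s hs
    by_cases hms : |m| ≤ s
    · have := (le_div_iff₀ hKpos).2 (hbig s hs hms)
      have h0 : 0 ≤ W * Real.exp (-(a * d ^ 2 / 4) * N) := by positivity
      linarith
    · have := hsmall s hs hms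
      have h0 : 0 ≤ Z / K := by positivity
      linarith
  have hsum : W ≤ (N + 1) * (Z / K) + W / 2 := by
    calc W = ∑ s ∈ szValues N, f s := htot.symm
      _ ≤ (szValues N).card • (Z / K + W * Real.exp (-(a * d ^ 2 / 4) * N)) :=
        Finset.sum_le_card_nsmul _ _ _ hall
      _ ≤ (N + 1) * (Z / K + W * Real.exp (-(a * d ^ 2 / 4) * N)) := by
        rw [nsmul_eq_mul]
        exact mul_le_mul_of_nonneg_right hcard (by positivity)
      _ = (N + 1) * (Z / K) + W * (((N : ℝ) + 1) * Real.exp (-(a * d ^ 2 / 4) * N)) := by ring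
      _ ≤ (N + 1) * (Z / K) + W * (1 / 2) := by gcongr
      _ = _ := by ring
  have hWK : W * K ≤ 2 * (N + 1) * Z := by
    have : W ≤ 2 * (N + 1) * Z / K := by
      have e : 2 * (N + 1) * Z / K = 2 * ((N + 1) * (Z / K)) := by ring
      rw [e]; linarith
    rwa [le_div_iff₀ hKpos] at this
  have e : Real.exp (N * (cwFree a x₀ + a * y₀ ^ 2)) = W * K * Real.exp a := by
    rw [hW, hK, ← Real.exp_add, ← Real.exp_add]
    congr 1; ring
  rw [e]
  calc W * K * Real.exp a ≤ 2 * (N + 1) * Z * Real.exp a := by gcongr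
    _ = _ := by ring

/-- The basis vectors whose scaled quantum numbers are at distance at least `δ` from the
saddle point. -/
def badSet (b : SpinBasis N) (x y δ : ℝ) : Finset (Conf N) :=
  Finset.univ.filter fun i => δ ≤ |b.s i / N - x| ∨ δ ≤ |b.sz i / N - y|

theorem sum_bad_le (h : IsSaddle β ε Tc x₀ y₀) {δ : ℝ} (hδ : 0 < δ) :
    ∃ c > 0, ∀ N : ℕ, N ≠ 0 → ∀ b : SpinBasis N,
      ∑ i ∈ badSet b x₀ y₀ δ, Real.exp (-β * eta ε Tc N (b.s i) (b.sz i)) ≤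
        (N + 1) ^ 2 * (Real.exp (2 * β * Tc) *
          Real.exp (N * (cwFree (2 * β * Tc) x₀ + 2 * β * Tc * y₀ ^ 2 - c))) := by
  have ha := h.coupling_pos
  obtain ⟨c₁, hc₁, hgap⟩ := exists_cwFree_gap ha h.pos h.tanh_eq hδ
  refine ⟨min c₁ (2 * β * Tc * δ ^ 2), lt_min hc₁ (by positivity), fun N hN b => ?_⟩
  set c := min c₁ (2 * β * Tc * δ ^ 2) with hc
  set B := Real.exp (2 * β * Tc) *
    Real.exp (N * (cwFree (2 * β * Tc) x₀ + 2 * β * Tc * y₀ ^ 2 - c)) with hB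
  have hB0 : 0 < B := by positivity
  rw [← Finset.sum_fiberwise_of_maps_to (s := badSet b x₀ y₀ δ) (t := szValues N ×ˢ szValues N)
    (g := fun i => (b.s i, b.sz i)) fun i _ => Finset.mem_product.2 ⟨b.s_mem i, b.sz_mem i⟩]
  have hfib : ∀ p ∈ szValues N ×ˢ szValues N,
      ∑ i ∈ badSet b x₀ y₀ δ with (b.s i, b.sz i) = p,
        Real.exp (-β * eta ε Tc N (b.s i) (b.sz i)) ≤ B := by
    rintro ⟨s, m⟩ hp
    obtain ⟨hs, hm⟩ := Finset.mem_product.1 hp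
    rcases (Finset.filter (fun i => (b.s i, b.sz i) = (s, m)) (badSet b x₀ y₀ δ)).eq_empty_or_nonempty
      with he | ⟨i₀, hi₀⟩
    · rw [he, Finset.sum_empty]; exact hB0.le
    have hbad : δ ≤ |s / N - x₀| ∨ δ ≤ |m / N - y₀| := by
      obtain ⟨h1, h2⟩ := Finset.mem_filter.1 hi₀
      obtain ⟨rfl, rfl⟩ := Prod.ext_iff.1 h2
      exact (Finset.mem_filter.1 h1).2
    have hs0 : 0 ≤ s := by
      obtain ⟨h1, h2⟩ := Finset.mem_filter.1 hi₀
      obtain ⟨rfl, rfl⟩ := Prod.ext_iff.1 h2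
      exact b.s_nonneg _
    have hcard : ((badSet b x₀ y₀ δ).filter fun i => (b.s i, b.sz i) = (s, m)).card ≤
        szCount N s := by
      refine (Finset.card_le_card fun i hi => ?_).trans (b.card_eigen_le s m)
      simpa using (Finset.mem_filter.1 hi).2
    calc ∑ i ∈ badSet b x₀ y₀ δ with (b.s i, b.sz i) = (s, m),
          Real.exp (-β * eta ε Tc N (b.s i) (b.sz i))
        = ∑ i ∈ badSet b x₀ y₀ δ with (b.s i, b.sz i) = (s, m),
          Real.exp (-β * eta ε Tc N s m) := Finset.sum_congr rfl fun i hi => by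
            obtain ⟨h1 : b.s i = s, h2 : b.sz i = m⟩ := Prod.ext_iff.1 (Finset.mem_filter.1 hi).2
            rw [h1, h2]
      _ ≤ szCount N s * Real.exp (-β * eta ε Tc N s m) := by
        rw [Finset.sum_const, nsmul_eq_mul]
        gcongr
      _ ≤ _ := h.szCount_mul_exp_le hN (abs_le_of_mem_szValues hs) (abs_le_of_mem_szValues hm)
      _ ≤ B := by
        rw [hB]
        refine mul_le_mul_of_nonneg_left (Real.exp_le_exp.2 ?_) (Real.exp_pos _).le
        refine mul_le_mul_of_nonneg_left ?_ (Nat.cast_nonneg _)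
        have h0 : 0 ≤ 2 * β * Tc * (m / N - y₀) ^ 2 := by positivity
        rcases hbad with hbad | hbad
        · have := hgap (s / N) (by positivity) hbad
          linarith [min_le_left c₁ (2 * β * Tc * δ ^ 2)]
        · have h1 := cwFree_le ha h.pos h.tanh_eq (s / N)
          have h2 : δ ^ 2 ≤ (m / N - y₀) ^ 2 := by
            rw [← sq_abs (m / N - y₀)]
            exact pow_le_pow_left₀ hδ.le hbad 2
          have h3 := mul_le_mul_of_nonneg_left h2 ha.le
          linarith [min_le_right c₁ (2 * β * Tc * δ ^ 2)]
  refine (Finset.sum_le_card_nsmul _ _ _ hfib).trans ?_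
  rw [nsmul_eq_mul, Finset.card_product]
  have hcard : ((szValues N).card : ℝ) ≤ N + 1 := by exact_mod_cast card_szValues_le N
  push_cast
  rw [sq]
  gcongr

theorem tendsto_sum_weight_bad (h : IsSaddle β ε Tc x₀ y₀) (b : ∀ N, SpinBasis N) {δ : ℝ}
    (hδ : 0 < δ) :
    Tendsto (fun N => ∑ i ∈ badSet (b N) x₀ y₀ δ, weight β ε Tc (b N) i) atTop (𝓝 0) := by
  obtain ⟨c, hc, hbad⟩ := h.sum_bad_le hδ
  have hlim : Tendsto (fun N : ℕ => 2 * Real.exp (2 * β * Tc) ^ 2 *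
      (((N : ℝ) + 1) ^ 3 * Real.exp (-c * N))) atTop (𝓝 0) := by
    simpa using (tendsto_add_one_pow_mul_exp 3 hc).const_mul (2 * Real.exp (2 * β * Tc) ^ 2)
  refine squeeze_zero' (Eventually.of_forall fun N => Finset.sum_nonneg fun i _ =>
    weight_nonneg ..) ?_ hlim
  filter_upwards [eventually_gt_atTop 0, h.partition_lower_bound] with N hN hlow
  have h1 := hbad N hN.ne' (b N)
  have h2 := hlow (b N)
  have hZ := partition_pos β ε Tc (b N)
  simp only [weight, ← Finset.sum_div]
  rw [div_le_iff₀ hZ]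
  refine h1.trans ?_
  have e : Real.exp (N * (cwFree (2 * β * Tc) x₀ + 2 * β * Tc * y₀ ^ 2 - c)) =
      Real.exp (-c * N) * Real.exp (N * (cwFree (2 * β * Tc) x₀ + 2 * β * Tc * y₀ ^ 2)) := by
    rw [← Real.exp_add]; congr 1; ring
  rw [e]
  calc _ ≤ ((N : ℝ) + 1) ^ 2 * (Real.exp (2 * β * Tc) * (Real.exp (-c * N) *
        (2 * (N + 1) * Real.exp (2 * β * Tc) *
          ∑ i, Real.exp (-β * eta ε Tc N ((b N).s i) ((b N).sz i))))) := by gcongr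
    _ = _ := by ring

end IsSaddle

theorem IsSaddle.tendsto_average {β ε Tc x₀ y₀ : ℝ} (h : IsSaddle β ε Tc x₀ y₀)
    (b : ∀ N, SpinBasis N) {G : ℝ × ℝ × ℝ → ℂ} (hG : Continuous G) :
    Tendsto (fun N => ∑ i, (weight β ε Tc (b N) i : ℂ) *
      G ((b N).s i / N, (b N).sz i / N, 1 / N)) atTop (𝓝 (G (x₀, y₀, 0))) := by
  obtain ⟨M, hM⟩ := (isCompact_Icc (a := ((-1 : ℝ), (-1 : ℝ), (-1 : ℝ)))
    (b := ((1 : ℝ), (1 : ℝ), (1 : ℝ)))).exists_bound_of_continuousOn hG.continuousOn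
  rw [Metric.tendsto_nhds]
  intro η hη
  obtain ⟨δ, hδ, hGδ⟩ := Metric.continuous_iff.1 hG (x₀, y₀, 0) (η / 2) (by positivity)
  set C := |M| + ‖G (x₀, y₀, 0)‖ + 1 with hC
  have hC0 : 0 < C := by positivity
  have hb := h.tendsto_sum_weight_bad b hδ
  have hlim : Tendsto (fun N : ℕ => (1 : ℝ) / N) atTop (𝓝 0) :=
    tendsto_one_div_atTop_nhds_zero_nat
  filter_upwards [eventually_gt_atTop 0, hb.eventually_lt_const (show 0 < η / (2 * C) by positivity),
    hlim.eventually_lt_const hδ] with N hN hbad hNδ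
  have hN1 : (1 : ℝ) ≤ N := by exact_mod_cast hN
  have hN' : (0 : ℝ) < N := by linarith
  set w := weight β ε Tc (b N) with hw
  have hw0 : ∀ i, 0 ≤ w i := weight_nonneg β ε Tc (b N)
  have hw1 : ∑ i, w i = 1 := sum_weight β ε Tc (b N)
  set p : Conf N → ℝ × ℝ × ℝ := fun i => ((b N).s i / N, (b N).sz i / N, 1 / N) with hp
  have hscaled : ∀ r ∈ szValues N, |r / N| ≤ 1 := by
    intro r hr
    rw [abs_div, Nat.abs_cast, div_le_one hN']
    linarith [abs_le_of_mem_szValues hr]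
  have hbound : ∀ i, ‖G (p i) - G (x₀, y₀, 0)‖ ≤ C := by
    intro i
    have h1 := abs_le.1 (hscaled _ ((b N).s_mem i))
    have h2 := abs_le.1 (hscaled _ ((b N).sz_mem i))
    have h3 : (1 : ℝ) / N ≤ 1 := (div_le_one hN').2 hN1
    have h4 : (0 : ℝ) ≤ 1 / N := by positivity
    have := hM (p i) ⟨⟨h1.1, h2.1, by simp only [hp]; linarith⟩, ⟨h1.2, h2.2, h3⟩⟩
    linarith [norm_sub_le (G (p i)) (G (x₀, y₀, 0)), le_abs_self M]
  have hgood : ∀ i ∉ badSet (b N) x₀ y₀ δ, ‖G (p i) - G (x₀, y₀, 0)‖ ≤ η / 2 := by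
    intro i hi
    simp only [badSet, Finset.mem_filter, Finset.mem_univ, true_and, not_or, not_le] at hi
    rw [← dist_eq_norm]
    refine (hGδ (p i) ?_).le
    simp only [hp, Prod.dist_eq, Real.dist_eq, sub_zero, max_lt_iff]
    exact ⟨hi.1, hi.2, by rwa [abs_of_nonneg (by positivity)]⟩
  have e : (∑ i, (w i : ℂ) * G (p i)) - G (x₀, y₀, 0) =
      ∑ i, (w i : ℂ) * (G (p i) - G (x₀, y₀, 0)) := by
    simp only [mul_sub, Finset.sum_sub_distrib, ← Finset.sum_mul]
    rw [← Complex.ofReal_sum, hw1, Complex.ofReal_one, one_mul]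
  rw [dist_eq_norm, e]
  calc ‖∑ i, (w i : ℂ) * (G (p i) - G (x₀, y₀, 0))‖
      ≤ ∑ i, w i * ‖G (p i) - G (x₀, y₀, 0)‖ := by
        refine (norm_sum_le _ _).trans_eq (Finset.sum_congr rfl fun i _ => ?_)
        rw [norm_mul, Complex.norm_real, Real.norm_of_nonneg (hw0 i)]
    _ ≤ ∑ i, (w i * (η / 2) + if i ∈ badSet (b N) x₀ y₀ δ then w i * C else 0) := by
        refine Finset.sum_le_sum fun i _ => ?_
        split_ifs with hi
        · have h1 := mul_le_mul_of_nonneg_left (hbound i) (hw0 i)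
          have h2 : 0 ≤ w i * (η / 2) := mul_nonneg (hw0 i) (by positivity)
          linarith
        · rw [add_zero]
          exact mul_le_mul_of_nonneg_left (hgood i hi) (hw0 i)
    _ = η / 2 + (∑ i ∈ badSet (b N) x₀ y₀ δ, w i) * C := by
        rw [Finset.sum_add_distrib, ← Finset.sum_mul, hw1, one_mul, Finset.sum_ite_mem,
          Finset.univ_inter, Finset.sum_mul]
    _ < η / 2 + η / (2 * C) * C := by gcongr
    _ = η := by field_simp; norm_num

theorem IsGap.isSaddle {β ε Tc Δ : ℝ} (hβ : 0 < β) (hTc : 0 < Tc) (h : IsGap β ε Tc Δ) :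
    IsSaddle β ε Tc (Real.sqrt (ε ^ 2 + 4 * Tc ^ 2 * Δ ^ 2) / (2 * Tc)) (ε / (2 * Tc)) where
  β_pos := hβ
  Tc_pos := hTc
  tanh_eq := by
    have e : 2 * β * Tc * (Real.sqrt (ε ^ 2 + 4 * Tc ^ 2 * Δ ^ 2) / (2 * Tc)) =
        β * Real.sqrt (ε ^ 2 + 4 * Tc ^ 2 * Δ ^ 2) := by field_simp
    rw [e, ← h.2]
    field_simp
  eps_eq := by field_simp
  abs_lt := by
    rw [abs_div, abs_of_pos (show 0 < 2 * Tc by positivity)]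
    refine div_lt_div_of_pos_right (Real.lt_sqrt_of_sq_lt ?_) (by positivity)
    rw [sq_abs]
    have := h.1
    have : 0 < 4 * Tc ^ 2 * Δ ^ 2 := by positivity
    linarith

theorem saddle_sq_sub_sq {ε Tc : ℝ} (hTc : 0 < Tc) (Δ : ℝ) :
    (Real.sqrt (ε ^ 2 + 4 * Tc ^ 2 * Δ ^ 2) / (2 * Tc)) ^ 2 - (ε / (2 * Tc)) ^ 2 = Δ ^ 2 := by
  rw [div_pow, Real.sq_sqrt (by positivity)]
  field_simp
  ring

theorem continuous_ladderSymbol (n m : ℕ) :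
    Continuous fun p : ℝ × ℝ × ℝ => ladderSymbol n m p.1 p.2.1 p.2.2 := by
  unfold ladderSymbol
  fun_prop

theorem ladderSymbol_zero (n m : ℕ) (x y : ℝ) :
    ladderSymbol n m x y 0 = (x ^ 2 - y ^ 2) ^ (n + m) := by
  simp [ladderSymbol, pow_add, sq]

theorem vacState_weyl (α : ℝ) (k l : ℤ) :
    vacState (expAngle (-k) ∘L expMomentum α ∘L expAngle l) =
      if l = k then Complex.exp (Complex.I * α * l) else 0 := by
  have h : inner ℂ (planeWave 0) (planeWave (-k + l)) = if l = k then (1 : ℂ) else 0 := by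
    have := orthonormal_iff_ite.1 (orthonormal_fourier (T := 2 * Real.pi)) 0 (-k + l)
    simp only [planeWave]
    rw [this]
    have e : (0 = -k + l) ↔ l = k := by constructor <;> intro h <;> omega
    simp only [e]
  rw [vacState, ContinuousLinearMap.comp_apply, ContinuousLinearMap.comp_apply, expAngle_planeWave,
    add_zero, expMomentum_planeWave, map_smul, expAngle_planeWave, inner_smul_right, h]
  split_ifs <;> simp

theorem expMomentum_zero : expMomentum 0 = ContinuousLinearMap.id ℂ CircleL2 := by
  ext1 ψ
  apply Lp.ext
  refine (Lp.coeFn_compMeasurePreserving ψ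
    (measurePreserving_add_right (AddCircle.haarAddCircle : Measure (AddCircle (2 * Real.pi)))
      ((0 : ℝ) : AddCircle (2 * Real.pi)))).trans (Eventually.of_forall fun φ => ?_)
  simp

theorem tendsto_gibbs_order_parameter {β ε Tc Δ : ℝ} (hβ : 0 < β) (hTc : 0 < Tc)
    (h : IsGap β ε Tc Δ) (b : ∀ N, SpinBasis N) :
    Tendsto (fun N : ℕ => Matrix.trace (gibbs β ε Tc N * (Sp N * Sm N)) / ((N : ℂ) ^ 2))
      atTop (𝓝 ((Δ : ℂ) ^ 2)) := by
  have hG : Continuous fun p : ℝ × ℝ × ℝ => (ladderSymbol 0 1 p.1 p.2.1 p.2.2 : ℂ) :=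
    Complex.continuous_ofReal.comp (continuous_ladderSymbol 0 1)
  have := (h.isSaddle hβ hTc).tendsto_average b hG
  simp only [ladderSymbol_zero, saddle_sq_sub_sq hTc] at this
  refine Tendsto.congr' ?_ (by simpa using this)
  filter_upwards [eventually_gt_atTop 0] with N hN
  rw [trace_gibbs_mul β ε Tc (b N), Finset.sum_div]
  refine Finset.sum_congr rfl fun i _ => ?_
  rw [mul_div_assoc]
  congr 1
  have hN' : (N : ℂ) ≠ 0 := by exact_mod_cast hN.ne'
  simp only [ladderSymbol, Finset.prod_range_zero, Finset.prod_range_one]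
  push_cast
  field_simp
  ring

theorem mesoLimit_bcsHmu {β ε Tc Δ : ℝ} (hβ : 0 < β) (hTc : 0 < Tc) (h : IsGap β ε Tc Δ)
    (b : ∀ N, SpinBasis N) (μ t : ℝ) :
    MesoLimit β ε Tc Δ b (fun N => gnsEvol (bcsHmu ε Tc μ N) t) (expMomentum (-(t * (2 * μ)))) := by
  intro n n' m m'
  rw [vacState_weyl]
  by_cases heq : (m : ℤ) - m' = (n : ℤ) - n'
  · rw [if_pos heq]
    have hG : Continuous fun p : ℝ × ℝ × ℝ =>
        Complex.exp (((-(t * bohrSymbol ε Tc μ (m - m') p.2.1 p.2.2) : ℝ) : ℂ) * Complex.I) *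
          (((Δ⁻¹) ^ (2 * (n + m')) * ladderSymbol n m' p.1 p.2.1 p.2.2 : ℝ) : ℂ) := by
      have := continuous_ladderSymbol n m'
      unfold bohrSymbol
      fun_prop
    have := (h.isSaddle hβ hTc).tendsto_average b hG
    simp only [ladderSymbol_zero, saddle_sq_sub_sq hTc] at this
    have hlim : Complex.exp (((-(t * bohrSymbol ε Tc μ (m - m') (ε / (2 * Tc)) 0) : ℝ) : ℂ) *
        Complex.I) * (((Δ⁻¹) ^ (2 * (n + m')) * (Δ ^ 2) ^ (n + m') : ℝ) : ℂ) =
        Complex.exp (Complex.I * ((-(t * (2 * μ)) : ℝ) : ℂ) * ((m : ℤ) - m' : ℤ)) := by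
      have e1 : (Δ⁻¹) ^ (2 * (n + m')) * (Δ ^ 2) ^ (n + m') = 1 := by
        rw [← pow_mul, ← mul_pow, inv_mul_cancel₀ h.1.ne', one_pow]
      have e2 : bohrSymbol ε Tc μ (m - m') (ε / (2 * Tc)) 0 = 2 * μ * (m - m') := by
        rw [bohrSymbol]; field_simp; ring
      rw [e1, e2, Complex.ofReal_one, mul_one]
      congr 1
      push_cast
      ring
    rw [hlim] at this
    refine Tendsto.congr' ?_ this
    filter_upwards [eventually_gt_atTop 0] with N hN
    exact (gnsExp_meso_of_eq β ε Tc μ Δ t hN.ne' (b N) heq).symm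
  · rw [if_neg heq]
    simp only [gnsExp_meso_of_ne β ε Tc μ Δ t (b _) heq]
    exact tendsto_const_nhds

theorem mesoLimit_bcsH {β ε Tc Δ : ℝ} (hβ : 0 < β) (hTc : 0 < Tc) (h : IsGap β ε Tc Δ)
    (b : ∀ N, SpinBasis N) (t : ℝ) :
    MesoLimit β ε Tc Δ b (fun N => gnsEvol (bcsH ε Tc N) t)
      (ContinuousLinearMap.id ℂ CircleL2) := by
  have := mesoLimit_bcsHmu hβ hTc h b 0 t
  simpa only [bcsHmu_zero, mul_zero, neg_zero, expMomentum_zero] using this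

end MesoBCS

end

theorem theorem2 (β ε Tc Δ : ℝ) (hβ : 0 < β) (hTc : 0 < Tc)
    (hΔ : MesoBCS.IsGap β ε Tc Δ) :
    Tendsto
      (fun N : ℕ => Matrix.trace (MesoBCS.gibbs β ε Tc N * (MesoBCS.Sp N * MesoBCS.Sm N)) /
        ((N : ℂ) ^ 2))
      atTop (𝓝 ((Δ : ℂ) ^ 2)) ∧
    ∀ b : (∀ N, MesoBCS.SpinBasis N),
      (∀ μ t : ℝ,
        MesoBCS.MesoLimit β ε Tc Δ b (fun N => MesoBCS.gnsEvol (MesoBCS.bcsHmu ε Tc μ N) t)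
          (MesoBCS.expMomentum (-(t * (2 * μ))))) ∧
      (∀ t : ℝ,
        MesoBCS.MesoLimit β ε Tc Δ b (fun N => MesoBCS.gnsEvol (MesoBCS.bcsH ε Tc N) t)
          (ContinuousLinearMap.id ℂ MesoBCS.CircleL2)) :=
  ⟨MesoBCS.tendsto_gibbs_order_parameter hβ hTc hΔ fun N => Classical.choice
      (MesoBCS.spinBasis_nonempty N),
    fun b => ⟨fun μ t => MesoBCS.mesoLimit_bcsHmu hβ hTc hΔ b μ t,
      fun t => MesoBCS.mesoLimit_bcsH hβ hTc hΔ b t⟩⟩
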